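/- Let $H$ be a finite hypergraph. A configuration is a map $w : V(H) \to \mathbb{Z}_2$; the value $w(v) = 1$ means that there is a ball at $v$. In one move of the (nondeterministic) hyperedge switching process one chooses a hyperedge $e$ that contains at least one ball, and replaces $w(v)$ by $1 + w(v)$ for all $v \in e$, leaving the other values unchanged. A configuration $w'$ is reachable from $w$ if it is obtained from $w$ by finitely many (possibly zero) moves. A configuration $s$ is recurrent for the process started at $w_1$ if for every infinite path $(\pi_0, \pi_1, \dots)$ of the process with $\pi_0 = w_1$ and for every $n$, $s$ is reachable from $\pi_n$; here the process stays forever in a configuration in which no move is possible. Theorem. There is a polynomial-time algorithm which, given a finite connected hypergraph $H$ all of whose hyperedges have at least three vertices, a configuration $w_1 \neq \mathbf{0}$ on $H$ and a configuration $w_2$ on $H$, decides whether $w_2$ is recurrent for the hyperedge switching process on $H$ started at $w_1$. -/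

import Mathlib

/-! ### The hyperedge switching process

Hypergraphs are Mathlib's `Hypergraph V`.  Configurations are functions `V → ZMod 2`; the value `1`
at `v` means that there is a ball at `v`.  They are used below for hypergraphs whose vertex set is
the whole type `V`. -/

namespace HyperedgeSwitching

variable {V : Type}

/-- Any two vertices are joined by a chain of vertices in which consecutive ones share a
hyperedge. -/
def IsConnected (H : Hypergraph V) : Prop :=
  ∀ u ∈ H.vertexSet, ∀ v ∈ H.vertexSet, Relation.ReflTransGen H.Adj u v

/-- Every hyperedge has more than two vertices. -/
def NoGraphEdges (H : Hypergraph V) : Prop :=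
  ∀ e ∈ H.edgeSet, 3 ≤ e.encard

open Classical in
/-- The configuration obtained from `x` by switching all vertices of `l`: balls are put on the empty
vertices of `l` and removed from the nonempty ones. -/
noncomputable def switch (l : Set V) (x : V → ZMod 2) : V → ZMod 2 :=
  fun v => if v ∈ l then 1 + x v else x v

/-- One move: choose a hyperedge that contains at least one ball and switch it. -/
def Step (H : Hypergraph V) (x y : V → ZMod 2) : Prop :=
  ∃ l ∈ H.edgeSet, (∃ v ∈ l, x v = 1) ∧ y = switch l x

/-- `y` can be reached from `x` by finitely many (possibly zero) moves. -/
def Reachable (H : Hypergraph V) : (V → ZMod 2) → (V → ZMod 2) → Prop :=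
  Relation.ReflTransGen (Step H)

/-- An infinite path of the process.  In a configuration without any available move the system
stays where it is. -/
def IsPath (H : Hypergraph V) (π : ℕ → V → ZMod 2) : Prop :=
  ∀ t, Step H (π t) (π (t + 1)) ∨ ((∀ y, ¬ Step H (π t) y) ∧ π (t + 1) = π t)

/-- `s` is recurrent for the process started at `w`: on any infinite path from `w`, `s` is reachable
from every configuration of the path. -/
def IsRecurrent (H : Hypergraph V) (w s : V → ZMod 2) : Prop :=
  ∀ π : ℕ → V → ZMod 2, IsPath H π → π 0 = w → ∀ t, Reachable H (π t) s

end HyperedgeSwitching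

/-! ### Random access machines and polynomial time

A random access machine with unbounded registers and an unbounded, indirectly addressed memory, both
holding natural numbers.  The arithmetic instructions are addition and truncated subtraction
only (no multiplication), so that unit-cost time is polynomially equivalent to Turing machine
time. -/

namespace RAM

/-- A state of the machine: the contents of the registers and of the memory. -/
structure State where
  reg : ℕ → ℕ
  mem : ℕ → ℕ

/-- Write `a` into register `i`. -/
def State.setReg (s : State) (i a : ℕ) : State :=
  { s with reg := Function.update s.reg i a }

/-- Write `a` into memory cell `i`. -/
def State.setMem (s : State) (i a : ℕ) : State :=
  { s with mem := Function.update s.mem i a }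

/-- Programs.  Their arguments are register names, except for the second argument of `const`, which
is a constant. -/
inductive Program where
  /-- `r i := c` -/
  | const (i c : ℕ)
  /-- `r i := r j` -/
  | copy (i j : ℕ)
  /-- `r i := r j + r k` -/
  | add (i j k : ℕ)
  /-- `r i := r j - r k`, truncated at zero -/
  | sub (i j k : ℕ)
  /-- `r i := mem (r j)` -/
  | load (i j : ℕ)
  /-- `mem (r i) := r j` -/
  | store (i j : ℕ)
  /-- first `p`, then `q` -/
  | seq (p q : Program)
  /-- if `r i ≠ 0` then `p` else `q` -/
  | ite (i : ℕ) (p q : Program)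
  /-- while `r i ≠ 0` do `p` -/
  | loop (i : ℕ) (p : Program)

/-- `Run p s t s'`: started in state `s`, the program `p` halts in state `s'` after exactly `t`
steps.  Every executed instruction and every evaluated test costs one step. -/
inductive Run : Program → State → ℕ → State → Prop
  | const (i c : ℕ) (s : State) : Run (.const i c) s 1 (s.setReg i c)
  | copy (i j : ℕ) (s : State) : Run (.copy i j) s 1 (s.setReg i (s.reg j))
  | add (i j k : ℕ) (s : State) : Run (.add i j k) s 1 (s.setReg i (s.reg j + s.reg k))
  | sub (i j k : ℕ) (s : State) : Run (.sub i j k) s 1 (s.setReg i (s.reg j - s.reg k))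
  | load (i j : ℕ) (s : State) : Run (.load i j) s 1 (s.setReg i (s.mem (s.reg j)))
  | store (i j : ℕ) (s : State) : Run (.store i j) s 1 (s.setMem (s.reg i) (s.reg j))
  | seq {p q : Program} {s s' s'' : State} {t t' : ℕ} :
      Run p s t s' → Run q s' t' s'' → Run (.seq p q) s (t + t') s''
  | ite_true {i : ℕ} {p q : Program} {s s' : State} {t : ℕ} :
      s.reg i ≠ 0 → Run p s t s' → Run (.ite i p q) s (t + 1) s'
  | ite_false {i : ℕ} {p q : Program} {s s' : State} {t : ℕ} :
      s.reg i = 0 → Run q s t s' → Run (.ite i p q) s (t + 1) s'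
  | loop_exit {i : ℕ} {p : Program} {s : State} :
      s.reg i = 0 → Run (.loop i p) s 1 s
  | loop_next {i : ℕ} {p : Program} {s s' s'' : State} {t t' : ℕ} :
      s.reg i ≠ 0 → Run p s t s' → Run (.loop i p) s' t' s'' → Run (.loop i p) s (t + t' + 1) s''

/-- The start state on an input word: the word is in the memory cells `0, 1, …`, its length is in
register `0`, and everything else is zero. -/
def start (w : List ℕ) : State where
  reg := fun i => if i = 0 then w.length else 0
  mem := fun i => w.getD i 0

/-- The size of an input word: the total binary length of its entries, plus one per entry. -/
def inputSize (w : List ℕ) : ℕ :=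
  (w.map fun a => Nat.size a + 1).sum

/-- Some program decides `P a` for all inputs `a` that satisfy the promise `D`, in a number of steps
that is bounded by a polynomial in the size of the encoding of `a`.  The answer is left in
register `0`. -/
def DecidableInPolyTime {α : Type} (encode : α → List ℕ) (D P : α → Prop) : Prop :=
  ∃ (p : Program) (b : Polynomial ℕ), ∀ a, D a →
    ∃ (t : ℕ) (s : State), Run p (start (encode a)) t s ∧ t ≤ b.eval (inputSize (encode a)) ∧
      ((P a ∧ s.reg 0 = 1) ∨ (¬ P a ∧ s.reg 0 = 0))

end RAM

/-! ### The inputs of the recurrence problem -/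

/-- A finite hypergraph with vertex set `Fin n`, given by a list of its hyperedges, and two
configurations. -/
structure RecurrenceInput where
  n : ℕ
  edges : List (Finset (Fin n))
  w₁ : Fin n → ZMod 2
  w₂ : Fin n → ZMod 2

namespace RecurrenceInput

/-- The hypergraph of the input. -/
def hypergraph (I : RecurrenceInput) : Hypergraph (Fin I.n) where
  vertexSet := Set.univ
  edgeSet := {l | ∃ e ∈ I.edges, l = (e : Set (Fin I.n))}
  subset_vertexSet_of_mem_edgeSet' := fun _ _ => Set.subset_univ _

/-- The input as a word: the number of vertices, the number of listed hyperedges, the 0-1 incidence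
vectors of the hyperedges, and the two configurations as 0-1 vectors. -/
def encode (I : RecurrenceInput) : List ℕ :=
  I.n :: I.edges.length ::
    (I.edges.flatMap (fun e => List.ofFn fun v => if v ∈ e then 1 else 0) ++
      List.ofFn (fun v => (I.w₁ v).val) ++ List.ofFn (fun v => (I.w₂ v).val))

end RecurrenceInput

/-! ### A small imperative language that compiles to polynomial-time RAM programs

All loops are bounded by register `0`, which holds the length of the input and is never changed
before the very end.  The running time is therefore bounded by a polynomial that depends on the
program text only. -/

namespace RAM

open Finset Polynomial

/-- Expressions over registers and memory.  `sum x b` is the sum of `b` over all values of register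
`x` that are smaller than register `0`. -/
inductive NatExpr where
  | lit (c : ℕ)
  | var (x : ℕ)
  | add (a b : NatExpr)
  | sub (a b : NatExpr)
  | ite (c a b : NatExpr)
  | mem (a : NatExpr)
  | sum (x : ℕ) (b : NatExpr)

namespace NatExpr

def eval : NatExpr → State → ℕ
  | lit c, _ => c
  | var x, s => s.reg x
  | add a b, s => a.eval s + b.eval s
  | sub a b, s => a.eval s - b.eval s
  | ite c a b, s => if c.eval s ≠ 0 then a.eval s else b.eval s
  | mem a, s => s.mem (a.eval s)
  | sum x b, s => ∑ i ∈ range (s.reg 0), b.eval (s.setReg x i)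

/-- All registers that occur are below `K`, and register `0` is not used as a loop variable. -/
def Below (K : ℕ) : NatExpr → Prop
  | lit _ => True
  | var x => x < K
  | add a b => a.Below K ∧ b.Below K
  | sub a b => a.Below K ∧ b.Below K
  | ite c a b => c.Below K ∧ a.Below K ∧ b.Below K
  | mem a => a.Below K
  | sum x b => 0 < x ∧ x < K ∧ b.Below K

/-- A program that leaves the value in register `k` and uses no other registers from `k` on
permanently. -/
def compile : NatExpr → ℕ → Program
  | lit c, k => .const k c
  | var x, k => .copy k x
  | add a b, k => .seq (a.compile k) (.seq (b.compile (k + 1)) (.add k k (k + 1)))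
  | sub a b, k => .seq (a.compile k) (.seq (b.compile (k + 1)) (.sub k k (k + 1)))
  | ite c a b, k => .seq (c.compile k) (.ite k (a.compile k) (b.compile k))
  | mem a, k => .seq (a.compile k) (.load k k)
  | sum x b, k =>
      .seq (.copy k x) (.seq (.const (k + 1) 0) (.seq (.copy (k + 2) 0) (.seq (.const (k + 3) 1)
        (.seq (.loop (k + 2) (.seq (.sub (k + 2) (k + 2) (k + 3)) (.seq (.copy x (k + 2))
          (.seq (b.compile (k + 4)) (.add (k + 1) (k + 1) (k + 4))))))
        (.seq (.copy x k) (.copy k (k + 1)))))))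

noncomputable def cost : NatExpr → ℕ[X]
  | lit _ => 1
  | var _ => 1
  | add a b => a.cost + b.cost + 1
  | sub a b => a.cost + b.cost + 1
  | ite c a b => c.cost + a.cost + b.cost + 1
  | mem a => a.cost + 1
  | sum _ b => X * (b.cost + 4) + 7

end NatExpr

/-- Agreement in the memory and in the registers below `K`. -/
def Agree (K : ℕ) (s s' : State) : Prop :=
  s.mem = s'.mem ∧ ∀ i < K, s.reg i = s'.reg i

theorem Agree.refl (K : ℕ) (s : State) : Agree K s s := ⟨rfl, fun _ _ => rfl⟩

theorem Agree.trans {K : ℕ} {s s' s'' : State} (h : Agree K s s') (h' : Agree K s' s'') :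
    Agree K s s'' :=
  ⟨h.1.trans h'.1, fun i hi => (h.2 i hi).trans (h'.2 i hi)⟩

theorem Agree.mono {K k : ℕ} {s s' : State} (h : Agree k s s') (hK : K ≤ k) : Agree K s s' :=
  ⟨h.1, fun i hi => h.2 i (hi.trans_le hK)⟩

theorem Agree.setReg {K : ℕ} {s s' : State} (h : Agree K s s') (x a : ℕ) :
    Agree K (s.setReg x a) (s'.setReg x a) := by
  refine ⟨h.1, fun i hi => ?_⟩
  by_cases hx : i = x
  · simp [State.setReg, hx]
  · simp [State.setReg, hx, h.2 i hi]

theorem Agree.setMem {K : ℕ} {s s' : State} (h : Agree K s s') (x a : ℕ) :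
    Agree K (s.setMem x a) (s'.setMem x a) :=
  ⟨by simp [State.setMem, h.1], h.2⟩

theorem agree_setReg {K k : ℕ} (s : State) (a : ℕ) (h : K ≤ k) : Agree K (s.setReg k a) s :=
  ⟨rfl, fun i hi => by simp [State.setReg, (hi.trans_le h).ne]⟩

@[simp] theorem State.setReg_reg (s : State) (i a j : ℕ) :
    (s.setReg i a).reg j = if j = i then a else s.reg j := by
  simp [State.setReg, Function.update_apply]

@[simp] theorem State.setReg_mem (s : State) (i a : ℕ) : (s.setReg i a).mem = s.mem := rfl

@[simp] theorem State.setMem_reg (s : State) (i a : ℕ) : (s.setMem i a).reg = s.reg := rfl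

@[simp] theorem State.setMem_mem (s : State) (i a j : ℕ) :
    (s.setMem i a).mem j = if j = i then a else s.mem j := by
  simp [State.setMem, Function.update_apply]

theorem NatExpr.eval_congr {K : ℕ} (hK : 0 < K) : ∀ (e : NatExpr) {s s' : State}, e.Below K →
    Agree K s s' → e.eval s = e.eval s'
  | lit _, _, _, _, _ => rfl
  | var x, _, _, h, hs => hs.2 x h
  | add a b, _, _, h, hs => by
      simp only [eval, eval_congr hK a h.1 hs, eval_congr hK b h.2 hs]
  | sub a b, _, _, h, hs => by
      simp only [eval, eval_congr hK a h.1 hs, eval_congr hK b h.2 hs]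
  | ite c a b, _, _, h, hs => by
      simp only [eval, eval_congr hK c h.1 hs, eval_congr hK a h.2.1 hs, eval_congr hK b h.2.2 hs]
  | mem a, _, _, h, hs => by
      simp only [eval, eval_congr hK a h hs, hs.1]
  | sum x b, s, s', h, hs => by
      simp only [eval, hs.2 0 hK]
      exact Finset.sum_congr rfl fun i _ => eval_congr hK b h.2.2 (hs.setReg x i)

theorem run_countdown {c : ℕ} {p : Program} (Inv : ℕ → State → Prop) (T : ℕ)
    (hp : ∀ j s, Inv (j + 1) s → s.reg c = j + 1 →
      ∃ t s', Run p s t s' ∧ t ≤ T ∧ Inv j s' ∧ s'.reg c = j) :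
    ∀ j s, Inv j s → s.reg c = j →
      ∃ t s', Run (.loop c p) s t s' ∧ t ≤ j * (T + 1) + 1 ∧ Inv 0 s'
  | 0, s, h, hc => ⟨1, s, .loop_exit hc, by simp, h⟩
  | j + 1, s, h, hc => by
      obtain ⟨t, s', hr, ht, hi, hc'⟩ := hp j s h hc
      obtain ⟨t', s'', hr', ht', hi'⟩ := run_countdown Inv T hp j s' hi hc'
      exact ⟨_, s'', .loop_next (by omega) hr hr', by linarith, hi'⟩

theorem NatExpr.run_compile {K : ℕ} (hK : 0 < K) : ∀ (e : NatExpr) (k : ℕ) (s : State),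
    e.Below K → K ≤ k → ∃ t s', Run (e.compile k) s t s' ∧ t ≤ e.cost.eval (s.reg 0) ∧ Agree k s' s ∧
      s'.reg k = e.eval s
  | lit c, k, s, _, _ =>
      ⟨1, _, .const k c s, by simp [cost], agree_setReg s _ le_rfl, by simp [eval]⟩
  | var x, k, s, _, _ =>
      ⟨1, _, .copy k x s, by simp [cost], agree_setReg s _ le_rfl, by simp [eval]⟩
  | add a b, k, s, h, hk => by
      obtain ⟨t₁, s₁, r₁, c₁, a₁, v₁⟩ := run_compile hK a k s h.1 hk
      obtain ⟨t₂, s₂, r₂, c₂, a₂, v₂⟩ := run_compile hK b (k + 1) s₁ h.2 (by omega)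
      refine ⟨_, _, .seq r₁ (.seq r₂ (.add k k (k + 1) s₂)), ?_, ?_, ?_⟩
      · rw [a₁.2 0 (by omega)] at c₂
        simp only [cost, eval_add, eval_one]; omega
      · exact (agree_setReg s₂ _ le_rfl).trans ((a₂.mono (by omega)).trans a₁)
      · simp [eval, v₂, a₂.2 k (by omega), v₁, eval_congr hK b h.2 (a₁.mono hk)]
  | sub a b, k, s, h, hk => by
      obtain ⟨t₁, s₁, r₁, c₁, a₁, v₁⟩ := run_compile hK a k s h.1 hk
      obtain ⟨t₂, s₂, r₂, c₂, a₂, v₂⟩ := run_compile hK b (k + 1) s₁ h.2 (by omega)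
      refine ⟨_, _, .seq r₁ (.seq r₂ (.sub k k (k + 1) s₂)), ?_, ?_, ?_⟩
      · rw [a₁.2 0 (by omega)] at c₂
        simp only [cost, eval_add, eval_one]; omega
      · exact (agree_setReg s₂ _ le_rfl).trans ((a₂.mono (by omega)).trans a₁)
      · simp [eval, v₂, a₂.2 k (by omega), v₁, eval_congr hK b h.2 (a₁.mono hk)]
  | ite c a b, k, s, h, hk => by
      obtain ⟨t₁, s₁, r₁, c₁, a₁, v₁⟩ := run_compile hK c k s h.1 hk
      by_cases hc : c.eval s = 0
      · obtain ⟨t₂, s₂, r₂, c₂, a₂, v₂⟩ := run_compile hK b k s₁ h.2.2 hk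
        refine ⟨_, _, .seq r₁ (.ite_false (by rw [v₁, hc]) r₂), ?_, a₂.trans a₁, ?_⟩
        · rw [a₁.2 0 (by omega)] at c₂
          simp only [cost, eval_add, eval_one]; omega
        · simp [eval, hc, v₂, eval_congr hK b h.2.2 (a₁.mono hk)]
      · obtain ⟨t₂, s₂, r₂, c₂, a₂, v₂⟩ := run_compile hK a k s₁ h.2.1 hk
        refine ⟨_, _, .seq r₁ (.ite_true (by rwa [v₁]) r₂), ?_, a₂.trans a₁, ?_⟩
        · rw [a₁.2 0 (by omega)] at c₂
          simp only [cost, eval_add, eval_one]; omega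
        · simp [eval, hc, v₂, eval_congr hK a h.2.1 (a₁.mono hk)]
  | mem a, k, s, h, hk => by
      obtain ⟨t₁, s₁, r₁, c₁, a₁, v₁⟩ := run_compile hK a k s h hk
      refine ⟨_, _, .seq r₁ (.load k k s₁), ?_, (agree_setReg s₁ _ le_rfl).trans a₁, ?_⟩
      · simp only [cost, eval_add, eval_one]; omega
      · simp [eval, v₁, a₁.1]
  | sum x b, k, s, h, hk => by
      obtain ⟨hx0, hxK, hb⟩ := h
      set s₁ := (((s.setReg k (s.reg x)).setReg (k + 1) 0).setReg (k + 2) (s.reg 0)).setReg (k + 3) 1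
        with hs₁
      have hne : ∀ i, i < K → i ≠ k ∧ i ≠ k + 1 ∧ i ≠ k + 2 ∧ i ≠ k + 3 := fun i hi => by omega
      obtain ⟨t, s', r, ht, hi⟩ := run_countdown (c := k + 2) (p := .seq (.sub (k + 2) (k + 2) (k + 3))
          (.seq (.copy x (k + 2)) (.seq (b.compile (k + 4)) (.add (k + 1) (k + 1) (k + 4)))))
        (fun j u => u.mem = s.mem ∧ (∀ i < k, i ≠ x → u.reg i = s.reg i) ∧ u.reg k = s.reg x ∧
          u.reg (k + 3) = 1 ∧ j ≤ s.reg 0 ∧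
          u.reg (k + 1) + ∑ i ∈ range j, b.eval (s.setReg x i) = (sum x b).eval s)
        (b.cost.eval (s.reg 0) + 3) (by
          rintro j u ⟨hm, hr, hkx, h3, hj, hsum⟩ hc
          set u₁ := (u.setReg (k + 2) j).setReg x j with hu₁
          have e0 : u₁.reg 0 = s.reg 0 := by
            simp [hu₁, hx0.ne, hr 0 (by omega) hx0.ne]
          obtain ⟨t, u₂, r, ht, ha, hv⟩ := run_compile hK b (k + 4) u₁ hb (by omega)
          have hux : Agree K u₁ (s.setReg x j) := by
            refine ⟨hm, fun i hi => ?_⟩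
            by_cases hix : i = x
            · simp [hu₁, hix]
            · simp [hu₁, hix, (hne i hi).2.2.1, hr i (by omega) hix]
          rw [eval_congr hK b hb hux] at hv
          refine ⟨_, _, .seq (.sub _ _ _ u) (.seq (.copy x (k + 2) _) (.seq (t := t) (s' := u₂) ?_
            (.add _ _ _ u₂))), ?_, ⟨?_, ?_, ?_, ?_, ?_, ?_⟩, ?_⟩
          · have : (u.setReg (k + 2) (u.reg (k + 2) - u.reg (k + 3))).setReg x
              ((u.setReg (k + 2) (u.reg (k + 2) - u.reg (k + 3))).reg (k + 2)) = u₁ := by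
              simp [hu₁, hc, h3]
            rw [this]; exact r
          · rw [e0] at ht; omega
          · simp [ha.1, hu₁, hm]
          · intro i hi hix
            simp [ha.2 i (by omega), hu₁, hix, hr i hi hix, show i ≠ k + 2 by omega,
              show i ≠ k + 1 by omega]
          · simp [ha.2 k (by omega), hu₁, hkx, show k ≠ x by omega]
          · simp [ha.2 (k + 3) (by omega), hu₁, h3, show k + 3 ≠ x by omega]
          · omega
          · rw [← hsum, Finset.sum_range_succ]
            simp [ha.2 (k + 1) (by omega), hu₁, hv, show k + 1 ≠ x by omega]; ring
          · simp [ha.2 (k + 2) (by omega), hu₁, show k + 2 ≠ x by omega])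
        (s.reg 0) s₁ (by
          refine ⟨rfl, fun i hi hix => ?_, ?_, ?_, le_rfl, ?_⟩
          · simp [hs₁, show i ≠ k by omega, show i ≠ k + 1 by omega, show i ≠ k + 2 by omega,
              show i ≠ k + 3 by omega]
          · simp [hs₁]
          · simp [hs₁]
          · simp [hs₁, eval]) (by simp [hs₁])
      obtain ⟨hm, hr, hkx, h3, -, hsum⟩ := hi
      refine ⟨_, _, .seq (.copy k x s) (.seq (.const (k + 1) 0 _) (.seq (.copy (k + 2) 0 _)
        (.seq (.const (k + 3) 1 _) (.seq (t := t) (s' := s') ?_ (.seq (.copy x k _) (.copy k (k + 1) _)))))),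
        ?_, ⟨?_, ?_⟩, ?_⟩
      · have : ((((s.setReg k (s.reg x)).setReg (k + 1) 0).setReg (k + 2)
          (((s.setReg k (s.reg x)).setReg (k + 1) 0).reg 0)).setReg (k + 3) 1) = s₁ := by
          simp [hs₁, show 0 ≠ k by omega]
        rw [this]; exact r
      · simp only [cost, eval_add, eval_mul, eval_X, eval_ofNat]; linarith
      · simp [hm]
      · intro i hi
        by_cases hix : i = x
        · simp [hix, hkx, show x ≠ k by omega]
        · simp [hix, hr i hi hix, show i ≠ k by omega]
      · simpa [show k + 1 ≠ x by omega] using hsum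

/-- Statements.  `loop x p` executes `p` for all values of register `x` that are smaller than
register `0`, in decreasing order. -/
inductive Stmt where
  | skip
  | set (x : ℕ) (a : NatExpr)
  | store (a b : NatExpr)
  | seq (p q : Stmt)
  | ite (c : NatExpr) (p q : Stmt)
  | loop (x : ℕ) (p : Stmt)

/-- Apply `f (n - 1)`, …, `f 0` in this order. -/
def countdown (f : ℕ → State → State) : ℕ → State → State
  | 0, s => s
  | n + 1, s => countdown f n (f n s)

theorem countdown_induction {f : ℕ → State → State} (Inv : ℕ → State → Prop) {n : ℕ}
    (h : ∀ j < n, ∀ s, Inv (j + 1) s → Inv j (f j s)) {s : State} (hs : Inv n s) :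
    Inv 0 (countdown f n s) := by
  induction n generalizing s with
  | zero => exact hs
  | succ n ih => exact ih (fun j hj => h j (by omega)) (h n (by omega) s hs)

namespace Stmt

def exec : Stmt → State → State
  | skip, s => s
  | set x a, s => s.setReg x (a.eval s)
  | store a b, s => s.setMem (a.eval s) (b.eval s)
  | seq p q, s => q.exec (p.exec s)
  | ite c p q, s => if c.eval s ≠ 0 then p.exec s else q.exec s
  | loop x p, s => countdown (fun i u => p.exec (u.setReg x i)) (s.reg 0) s

def Below (K : ℕ) : Stmt → Prop
  | skip => True
  | set x a => 0 < x ∧ x < K ∧ a.Below K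
  | store a b => a.Below K ∧ b.Below K
  | seq p q => p.Below K ∧ q.Below K
  | ite c p q => c.Below K ∧ p.Below K ∧ q.Below K
  | loop x p => 0 < x ∧ x < K ∧ p.Below K

def compile : Stmt → ℕ → Program
  | skip, k => .const k 0
  | set x a, k => .seq (a.compile k) (.copy x k)
  | store a b, k => .seq (a.compile k) (.seq (b.compile (k + 1)) (.store k (k + 1)))
  | seq p q, k => .seq (p.compile k) (q.compile k)
  | ite c p q, k => .seq (c.compile k) (.ite k (p.compile k) (q.compile k))
  | loop x p, k => .seq (.copy k 0) (.seq (.const (k + 1) 1)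
      (.loop k (.seq (.sub k k (k + 1)) (.seq (.copy x k) (p.compile (k + 2))))))

noncomputable def cost : Stmt → ℕ[X]
  | skip => 1
  | set _ a => a.cost + 1
  | store a b => a.cost + b.cost + 1
  | seq p q => p.cost + q.cost
  | ite c p q => c.cost + p.cost + q.cost + 1
  | loop _ p => X * (p.cost + 3) + 3

theorem exec_reg_zero {K : ℕ} : ∀ (p : Stmt) (s : State), p.Below K → (p.exec s).reg 0 = s.reg 0
  | skip, _, _ => rfl
  | set x a, s, h => by simp [exec, h.1.ne]
  | store a b, s, _ => rfl
  | seq p q, s, h => by rw [exec, exec_reg_zero q _ h.2, exec_reg_zero p _ h.1]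
  | ite c p q, s, h => by
      rw [exec]; split_ifs
      · exact exec_reg_zero p _ h.2.1
      · exact exec_reg_zero q _ h.2.2
  | loop x p, s, h => by
      refine countdown_induction (fun _ u => u.reg 0 = s.reg 0) (fun j _ u hu => ?_) rfl
      rw [exec_reg_zero p _ h.2.2]
      simpa [h.1.ne] using hu

/-- The registers from `K` to `k - 1` are not changed. -/
def Keeps (K k : ℕ) (s s' : State) : Prop := ∀ i, K ≤ i → i < k → s'.reg i = s.reg i

theorem run_compile {K : ℕ} (hK : 0 < K) : ∀ (p : Stmt) (k : ℕ) (s u : State), p.Below K → K ≤ k →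
    Agree K s u → ∃ t s', Run (p.compile k) s t s' ∧ t ≤ p.cost.eval (u.reg 0) ∧
      Agree K s' (p.exec u) ∧ Keeps K k s s'
  | skip, k, s, u, _, hk, hs => ⟨1, _, .const k 0 s, by simp [cost], (agree_setReg s _ hk).trans hs,
      fun i _ h => (agree_setReg s 0 le_rfl).2 i h⟩
  | set x a, k, s, u, h, hk, hs => by
      obtain ⟨t₁, s₁, r₁, c₁, a₁, v₁⟩ := a.run_compile hK k s h.2.2 hk
      refine ⟨_, _, .seq r₁ (.copy x k s₁), ?_, ?_, fun i h1 h2 => ?_⟩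
      · rw [hs.2 0 hK] at c₁
        simp only [cost, eval_add, eval_one]; omega
      · rw [v₁, a.eval_congr hK h.2.2 hs]
        exact ((a₁.mono hk).trans hs).setReg _ _
      · have := h.2.1
        simp [show i ≠ x by omega, a₁.2 i h2]
  | store a b, k, s, u, h, hk, hs => by
      obtain ⟨t₁, s₁, r₁, c₁, a₁, v₁⟩ := a.run_compile hK k s h.1 hk
      obtain ⟨t₂, s₂, r₂, c₂, a₂, v₂⟩ := b.run_compile hK (k + 1) s₁ h.2 (by omega)
      have hs₁ := (a₁.mono hk).trans hs
      refine ⟨_, _, .seq r₁ (.seq r₂ (.store k (k + 1) s₂)), ?_, ?_, fun i h1 h2 => ?_⟩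
      · rw [hs₁.2 0 hK] at c₂
        rw [hs.2 0 hK] at c₁
        simp only [cost, eval_add, eval_one]; omega
      · rw [v₂, a₂.2 k (by omega), v₁, a.eval_congr hK h.1 hs, b.eval_congr hK h.2 hs₁]
        exact ((a₂.mono (by omega)).trans hs₁).setMem _ _
      · simp [a₂.2 i (by omega), a₁.2 i h2]
  | seq p q, k, s, u, h, hk, hs => by
      obtain ⟨t₁, s₁, r₁, c₁, a₁, v₁⟩ := run_compile hK p k s u h.1 hk hs
      obtain ⟨t₂, s₂, r₂, c₂, a₂, v₂⟩ := run_compile hK q k s₁ _ h.2 hk a₁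
      refine ⟨_, _, .seq r₁ r₂, ?_, a₂, fun i h1 h2 => (v₂ i h1 h2).trans (v₁ i h1 h2)⟩
      rw [exec_reg_zero p _ h.1] at c₂
      simp only [cost, eval_add]; omega
  | ite c p q, k, s, u, h, hk, hs => by
      obtain ⟨t₁, s₁, r₁, c₁, a₁, v₁⟩ := c.run_compile hK k s h.1 hk
      rw [hs.2 0 hK] at c₁
      rw [c.eval_congr hK h.1 hs] at v₁
      by_cases hc : c.eval u = 0
      · obtain ⟨t₂, s₂, r₂, c₂, a₂, v₂⟩ := run_compile hK q k s₁ u h.2.2 hk ((a₁.mono hk).trans hs)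
        refine ⟨_, _, .seq r₁ (.ite_false (by rw [v₁, hc]) r₂), ?_, by simpa [exec, hc] using a₂,
          fun i h1 h2 => (v₂ i h1 h2).trans (a₁.2 i h2)⟩
        simp only [cost, eval_add, eval_one]; omega
      · obtain ⟨t₂, s₂, r₂, c₂, a₂, v₂⟩ := run_compile hK p k s₁ u h.2.1 hk ((a₁.mono hk).trans hs)
        refine ⟨_, _, .seq r₁ (.ite_true (by rwa [v₁]) r₂), ?_, by simpa [exec, hc] using a₂,
          fun i h1 h2 => (v₂ i h1 h2).trans (a₁.2 i h2)⟩
        simp only [cost, eval_add, eval_one]; omega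
  | loop x p, k, s, u, h, hk, hs => by
      obtain ⟨hx0, hxK, hp⟩ := h
      set s₁ := (s.setReg k (s.reg 0)).setReg (k + 1) 1 with hs₁
      obtain ⟨t, s', r, ht, hi⟩ := run_countdown (c := k)
        (p := .seq (.sub k k (k + 1)) (.seq (.copy x k) (p.compile (k + 2))))
        (fun j v => v.reg (k + 1) = 1 ∧ Keeps K k s v ∧ ∃ w, w.reg 0 = u.reg 0 ∧ Agree K v w ∧
          countdown (fun i u => p.exec (u.setReg x i)) j w = (loop x p).exec u)
        (p.cost.eval (u.reg 0) + 2) (by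
          rintro j v ⟨h1, hkeep, w, hw0, hvw, hw⟩ hc
          set v₁ := (v.setReg k j).setReg x j with hv₁
          have hvw₁ : Agree K v₁ (w.setReg x j) := ((agree_setReg v j hk).trans hvw).setReg _ _
          have hw0' : (w.setReg x j).reg 0 = u.reg 0 := by simpa [hx0.ne] using hw0
          obtain ⟨t, v₂, r, ht, ha, hv⟩ := run_compile hK p (k + 2) v₁ _ hp (by omega) hvw₁
          refine ⟨_, v₂, .seq (.sub _ _ _ v) (.seq (.copy x k _) (t' := t) ?_), ?_,
            ⟨?_, fun i h1 h2 => ?_, _, ?_, ha, hw⟩, ?_⟩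
          · have : (v.setReg k (v.reg k - v.reg (k + 1))).setReg x
              ((v.setReg k (v.reg k - v.reg (k + 1))).reg k) = v₁ := by
              simp [hv₁, hc, h1]
            rw [this]; exact r
          · rw [hw0'] at ht; omega
          · rw [hv (k + 1) (by omega) (by omega)]
            simp [hv₁, h1, show k + 1 ≠ x by omega]
          · rw [hv i h1 (by omega), ← hkeep i h1 h2]
            simp [hv₁, show i ≠ x by omega, show i ≠ k by omega]
          · rw [exec_reg_zero p _ hp, hw0']
          · rw [hv k hk (by omega)]
            simp [hv₁, show k ≠ x by omega])
        (s.reg 0) s₁ (by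
          refine ⟨by simp [hs₁], fun i h1 h2 => ?_, u, rfl, ?_, ?_⟩
          · simp [hs₁, show i ≠ k by omega, show i ≠ k + 1 by omega]
          · exact ((agree_setReg _ _ (by omega)).trans (agree_setReg _ _ hk)).trans hs
          · rw [hs.2 0 hK, exec]) (by simp [hs₁])
      obtain ⟨-, hkeep, w, -, hsw, hw⟩ := hi
      refine ⟨_, s', .seq (.copy k 0 s) (.seq (.const (k + 1) 1 _) (t' := t) r), ?_, ?_, hkeep⟩
      · simp only [cost, eval_add, eval_mul, eval_X, eval_ofNat]
        rw [hs.2 0 hK] at ht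
        linarith
      · rw [← hw]; exact hsw

end Stmt

theorem eval_mono_nat (p : ℕ[X]) {a b : ℕ} (h : a ≤ b) : p.eval a ≤ p.eval b := by
  rw [eval_eq_sum_range, eval_eq_sum_range]
  exact Finset.sum_le_sum fun i _ => Nat.mul_le_mul_left _ (Nat.pow_le_pow_left h i)

theorem length_le_inputSize (w : List ℕ) : w.length ≤ inputSize w := by
  induction w with
  | nil => simp
  | cons a w ih => simp only [inputSize, List.map_cons, List.sum_cons, List.length_cons] at *; omega

/-- A statement followed by the evaluation of an expression decides in polynomial time. -/
theorem decidableInPolyTime_of_exec {α : Type} {encode : α → List ℕ} {D P : α → Prop} {K : ℕ}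
    (hK : 0 < K) (p : Stmt) (hp : p.Below K) (e : NatExpr) (he : e.Below K)
    (h : ∀ a, D a → (P a ∧ e.eval (p.exec (start (encode a))) = 1) ∨
      (¬ P a ∧ e.eval (p.exec (start (encode a))) = 0)) : DecidableInPolyTime encode D P := by
  refine ⟨.seq (p.compile K) (.seq (e.compile K) (.copy 0 K)), p.cost + e.cost + 1, fun a ha => ?_⟩
  obtain ⟨t₁, s₁, r₁, c₁, a₁, -⟩ := p.run_compile hK K _ _ hp le_rfl (Agree.refl K (start (encode a)))
  obtain ⟨t₂, s₂, r₂, c₂, a₂, v₂⟩ := e.run_compile hK K s₁ he le_rfl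
  rw [e.eval_congr hK he a₁] at v₂
  refine ⟨_, _, .seq r₁ (.seq r₂ (.copy 0 K s₂)), ?_, by simpa [v₂] using h a ha⟩
  have h0 : (start (encode a)).reg 0 = (encode a).length := by simp [start]
  rw [a₁.2 0 hK, p.exec_reg_zero _ hp] at c₂
  rw [h0] at c₁ c₂
  have := eval_mono_nat p.cost (length_le_inputSize (encode a))
  have := eval_mono_nat e.cost (length_le_inputSize (encode a))
  simp only [eval_add, eval_one]
  omega

end RAM

/-! ### Switching along a set of vectors over the field with two elements -/

namespace VectorSwitching

open Relation Submodule

variable {V : Type}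

/-- One move: add a vector of `E` that has a vertex in common with `x`. -/
def Move (E : Set (V → ZMod 2)) (x y : V → ZMod 2) : Prop :=
  ∃ e ∈ E, (∃ v, e v = 1 ∧ x v = 1) ∧ y = x + e

def Reach (E : Set (V → ZMod 2)) : (V → ZMod 2) → (V → ZMod 2) → Prop :=
  ReflTransGen (Move E)

/-- `v` lies on some edge. -/
def Covers (E : Set (V → ZMod 2)) (v : V) : Prop := ∃ e ∈ E, e v = 1

def Twin (E : Set (V → ZMod 2)) (u v : V) : Prop := ∀ e ∈ E, e u = e v

def Connected (E : Set (V → ZMod 2)) : Prop :=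
  ∀ u v, ReflTransGen (fun a b => ∃ e ∈ E, e a = 1 ∧ e b = 1) u v

theorem eq_zero_or_one (a : ZMod 2) : a = 0 ∨ a = 1 := by revert a; decide

theorem eq_one_of_ne_zero {a : ZMod 2} (h : a ≠ 0) : a = 1 := by revert a; decide

theorem eq_zero_of_ne_one {a : ZMod 2} (h : a ≠ 1) : a = 0 := by revert a; decide

theorem add_add_self (x e : V → ZMod 2) : x + e + e = x := by
  rw [add_assoc, ZModModule.add_self, add_zero]

theorem self_add_add (x e : V → ZMod 2) : x + (x + e) = e := by
  rw [← add_assoc, ZModModule.add_self, zero_add]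

theorem reach_of_meets {E : Set (V → ZMod 2)} {e x : V → ZMod 2} (he : e ∈ E) {v : V}
    (h : e v = 1) (hx : x v = 1) : Reach E x (x + e) :=
  .single ⟨e, he, ⟨v, h, hx⟩, rfl⟩

theorem Reach.mono {E E' : Set (V → ZMod 2)} (h : E ⊆ E') {x y : V → ZMod 2} (hr : Reach E x y) :
    Reach E' x y :=
  ReflTransGen.mono (r := Move E) (fun _ _ ⟨e, he, hm⟩ => ⟨e, h he, hm⟩) _ _ hr

theorem Reach.add_mem_span {E : Set (V → ZMod 2)} {x y : V → ZMod 2} (h : Reach E x y) :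
    x + y ∈ span (ZMod 2) E := by
  induction h with
  | refl => rw [ZModModule.add_self]; exact zero_mem _
  | tail _ hm ih =>
    obtain ⟨e, he, -, rfl⟩ := hm
    rw [← add_assoc]
    exact add_mem ih (subset_span he)

theorem Covers.mono {E E' : Set (V → ZMod 2)} (h : E ⊆ E') {v : V} (hv : Covers E v) :
    Covers E' v := by
  obtain ⟨e, he, hev⟩ := hv
  exact ⟨e, h he, hev⟩

theorem apply_eq_zero_of_not_covers {E : Set (V → ZMod 2)} {z : V → ZMod 2}
    (hz : z ∈ span (ZMod 2) E) {v : V} (hv : ¬ Covers E v) : z v = 0 := by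
  induction hz using span_induction with
  | mem e he => exact eq_zero_of_ne_one fun h => hv ⟨e, he, h⟩
  | zero => rfl
  | add x y _ _ hx hy => simp [hx, hy]
  | smul a x _ hx => simp [hx]

theorem eq_zero_of_covers {E : Set (V → ZMod 2)} {z : V → ZMod 2}
    (hz : z ∈ span (ZMod 2) E) (h : ∀ v, Covers E v → z v = 0) : z = 0 := by
  funext v
  by_cases hv : Covers E v
  · exact h v hv
  · exact apply_eq_zero_of_not_covers hz hv

theorem Twin.eq_of_mem_span {E : Set (V → ZMod 2)} {u v : V} (h : Twin E u v) {z : V → ZMod 2}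
    (hz : z ∈ span (ZMod 2) E) : z u = z v := by
  induction hz using span_induction with
  | mem e he => exact h e he
  | zero => rfl
  | add x y _ _ hx hy => simp [hx, hy]
  | smul a x _ hx => simp [hx]

theorem mem_span_insert_cases {E : Set (V → ZMod 2)} {e z : V → ZMod 2}
    (h : z ∈ span (ZMod 2) (insert e E)) : z ∈ span (ZMod 2) E ∨ z + e ∈ span (ZMod 2) E := by
  obtain ⟨a, w, hw, rfl⟩ := mem_span_insert.1 h
  rcases eq_zero_or_one a with rfl | rfl
  · left; simpa using hw
  · right
    rwa [one_smul, add_comm e w, add_add_self]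

/-- Among the configurations that satisfy `K`, all moves within a coset of the span of `E` are
possible, apart from those out of a configuration without balls on the vertices of `E` and those
into a configuration in which all these vertices have balls. -/
def Controls (K : (V → ZMod 2) → Prop) (E : Set (V → ZMod 2)) : Prop :=
  ∀ x y, K x → x + y ∈ span (ZMod 2) E → (∃ v, Covers E v ∧ x v = 1) →
    (∃ v, Covers E v ∧ y v = 0) → Reach E x y

theorem Controls.insert_of_cross {K : (V → ZMod 2) → Prop} {E : Set (V → ZMod 2)}
    {e : V → ZMod 2} (hK : ∀ x, K x → K (x + e))
    (h : Controls K E) (he : ∃ v, Covers E v ∧ e v = 1)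
    (cross : ∀ x y, K x → x + y + e ∈ span (ZMod 2) E → (∃ v, Covers E v ∧ x v = 1) →
      (∃ v, Covers E v ∧ y v = 0) → Reach (insert e E) x y) :
    Controls K (insert e E) := by
  have hsub : E ⊆ insert e E := Set.subset_insert e E
  have heE : e ∈ insert e E := Set.mem_insert e E
  obtain ⟨p, hp, hep⟩ := he
  have case1 : ∀ x y, K x → x + y ∈ span (ZMod 2) (insert e E) →
      (∃ v, Covers E v ∧ x v = 1) → (∃ v, Covers E v ∧ y v = 0) → Reach (insert e E) x y := by
    intro x y hx hxy h1 h0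
    rcases mem_span_insert_cases hxy with hs | hs
    · exact (h x y hx hs h1 h0).mono hsub
    · exact cross x y hx hs h1 h0
  have case2 : ∀ x y, K x → x + y ∈ span (ZMod 2) (insert e E) →
      (∃ v, Covers (insert e E) v ∧ x v = 1) → (∃ v, Covers E v ∧ y v = 0) →
      Reach (insert e E) x y := by
    rintro x y hx hxy ⟨v, ⟨f, hf, hfv⟩, hxv⟩ h0
    by_cases h1 : ∃ v, Covers E v ∧ x v = 1
    · exact case1 x y hx hxy h1 h0
    · push Not at h1
      obtain rfl | hf := hf
      · refine (reach_of_meets heE hfv hxv).trans (case1 _ y (hK x hx) ?_ ⟨p, hp, ?_⟩ h0)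
        · rw [add_right_comm]; exact add_mem hxy (subset_span heE)
        · simp [eq_zero_of_ne_one (h1 p hp), hep]
      · exact absurd hxv (h1 v ⟨f, hf, hfv⟩)
  rintro x y hx hxy h1 ⟨v, ⟨f, hf, hfv⟩, hyv⟩
  by_cases h0 : ∃ v, Covers E v ∧ y v = 0
  · exact case2 x y hx hxy h1 h0
  · push Not at h0
    obtain rfl | hf := hf
    · refine (case2 x (y + f) hx ?_ h1 ⟨p, hp, ?_⟩).trans ?_
      · rw [← add_assoc]; exact add_mem hxy (subset_span heE)
      · rw [Pi.add_apply, eq_one_of_ne_zero (h0 p hp), hep]; rfl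
      · have := reach_of_meets (x := y + f) heE hfv (by simp [hfv, hyv])
        rwa [add_add_self] at this
    · exact absurd hyv (h0 v ⟨f, hf, hfv⟩)

/-- The coset of `x` contains a configuration at which `e` can be added such that both this move and
its inverse connect configurations to which `Controls` applies. -/
abbrev CanCross (E : Set (V → ZMod 2)) (e x : V → ZMod 2) : Prop :=
  ∃ u, x + u ∈ span (ZMod 2) E ∧ (∃ v, e v = 1 ∧ u v = 1) ∧ (∃ v, Covers E v ∧ u v ≠ e v) ∧
    ∃ v, Covers E v ∧ u v = 0

theorem Controls.insert_of_good {K : (V → ZMod 2) → Prop} {E : Set (V → ZMod 2)}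
    {e : V → ZMod 2} (hK : ∀ x, K x → ∀ z ∈ span (ZMod 2) (insert e E), K (x + z))
    (h : Controls K E) (he : ∃ v, Covers E v ∧ e v = 1)
    (good : ∀ x, K x → CanCross E e x) :
    Controls K (insert e E) := by
  have hsub : E ⊆ insert e E := Set.subset_insert e E
  have heE : e ∈ insert e E := Set.mem_insert e E
  refine h.insert_of_cross (fun x hx => hK x hx e (subset_span heE)) he
    fun x y hx hxy h1 h0 => ?_
  obtain ⟨u, hxu, ⟨v, hev, huv⟩, ⟨q, hq, hne⟩, hmiss⟩ := good x hx
  refine ((h x u hx hxu h1 hmiss).mono hsub).trans ((reach_of_meets heE hev huv).trans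
    ((h _ y ?_ ?_ ⟨q, hq, ?_⟩ h0).mono hsub))
  · have := hK x hx (x + u + e) (add_mem (span_mono hsub hxu) (subset_span heE))
    rwa [add_assoc, self_add_add] at this
  · have : u + e + y = x + u + (x + y + e) := by
      rw [show x + u + (x + y + e) = x + (x + (u + e + y)) by abel, self_add_add]
    rw [this]
    exact add_mem hxu hxy
  · rw [Pi.add_apply]
    revert hne
    generalize u q = a
    generalize e q = b
    revert a b
    decide

theorem controls_singleton (K : (V → ZMod 2) → Prop) (e : V → ZMod 2) : Controls K {e} := by
  rintro x y - hxy ⟨v, ⟨f, rfl, hfv⟩, hxv⟩ -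
  obtain ⟨a, ha⟩ := mem_span_singleton.1 hxy
  have hy : y = x + a • f := by rw [ha, self_add_add]
  rcases eq_zero_or_one a with rfl | rfl
  · rw [hy, zero_smul, add_zero]; exact .refl
  · rw [hy, one_smul]
    exact reach_of_meets rfl hfv hxv

theorem controls_pair (e g : V → ZMod 2) {p : V} (hep : e p = 1) (hgp : g p = 1) :
    Controls (fun _ => True) {g, e} := by
  refine (controls_singleton _ e).insert_of_cross (fun _ _ => trivial) ⟨p, ⟨e, rfl, hep⟩, hgp⟩ ?_
  rintro x y - hxy ⟨v, ⟨f, rfl, hev⟩, hxv⟩ ⟨q, ⟨f', rfl, heq⟩, hyq⟩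
  have hf : f' ∈ ({g, f'} : Set (V → ZMod 2)) := by simp
  have hg : g ∈ ({g, f'} : Set (V → ZMod 2)) := by simp
  obtain ⟨a, ha⟩ := mem_span_singleton.1 hxy
  have hy : y = x + g + a • f' := by
    rw [ha, show x + g + (x + y + g) = x + (x + (y + g + g)) by abel, self_add_add, add_add_self]
  rcases eq_zero_or_one a with rfl | rfl
  · rw [zero_smul, add_zero] at hy
    subst hy
    by_cases hm : ∃ v, g v = 1 ∧ x v = 1
    · obtain ⟨v, h1, h2⟩ := hm
      exact reach_of_meets hg h1 h2
    · push Not at hm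
      have h1 := reach_of_meets hf hev hxv
      have h2 := reach_of_meets (x := x + f') hg hgp
        (by simp [hep, eq_zero_of_ne_one (hm p hgp)])
      have h3 := reach_of_meets (x := x + f' + g) hf heq (by
        rw [Pi.add_apply] at hyq
        rw [Pi.add_apply, Pi.add_apply, add_right_comm, hyq, heq, zero_add])
      have := (h1.trans h2).trans h3
      rwa [show x + f' + g + f' = x + g + f' + f' by abel, add_add_self] at this
  · rw [one_smul] at hy
    subst hy
    by_cases hm : ∃ v, g v = 1 ∧ (x + f') v = 1
    · obtain ⟨v, h1, h2⟩ := hm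
      have := (reach_of_meets hf hev hxv).trans (reach_of_meets hg h1 h2)
      rwa [add_right_comm] at this
    · push Not at hm
      have hxp : x p = 1 := by
        have := hm p hgp
        rw [Pi.add_apply, hep] at this
        revert this
        generalize x p = a
        revert a
        decide
      refine (reach_of_meets hg hgp hxp).trans (reach_of_meets hf heq ?_)
      rw [Pi.add_apply, Pi.add_apply, heq] at hyq
      rw [Pi.add_apply]
      revert hyq
      generalize x q + g q = a
      revert a
      decide

/-- Every value of a configuration at a covered vertex can be corrected by an edge. -/
theorem exists_add_mem_span_apply_eq_one {E : Set (V → ZMod 2)} {p : V} (hp : Covers E p)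
    (x : V → ZMod 2) : ∃ u, x + u ∈ span (ZMod 2) E ∧ u p = 1 := by
  obtain ⟨f, hf, hfp⟩ := hp
  rcases eq_zero_or_one (x p) with h | h
  · exact ⟨x + f, by rw [self_add_add]; exact subset_span hf, by simp [h, hfp]⟩
  · exact ⟨x, by rw [ZModModule.add_self]; exact zero_mem _, h⟩

theorem good_of_twins {E : Set (V → ZMod 2)} {e x : V → ZMod 2}
    (he : ∃ v, Covers E v ∧ e v = 1) {a b : V} (ha : Covers E a) (hab : Twin E a b)
    (heab : e a = e b) (hx : x a ≠ x b) :
    CanCross E e x := by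
  obtain ⟨p, hp, hep⟩ := he
  have hb : Covers E b := by
    obtain ⟨f, hf, hfa⟩ := ha
    exact ⟨f, hf, by rw [← hab f hf, hfa]⟩
  obtain ⟨u, hu, hup⟩ := exists_add_mem_span_apply_eq_one hp x
  have hne : u a ≠ u b := by
    have := hab.eq_of_mem_span hu
    simp only [Pi.add_apply] at this
    revert this hx
    generalize x a = a1
    generalize x b = b1
    generalize u a = a2
    generalize u b = b2
    revert a1 b1 a2 b2
    decide
  refine ⟨u, hu, ⟨p, hep, hup⟩, ?_, ?_⟩
  · by_cases h : u a = e a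
    · exact ⟨b, hb, fun h' => hne (by rw [h, h', heab])⟩
    · exact ⟨a, ha, h⟩
  · by_cases h : u a = 0
    · exact ⟨a, ha, h⟩
    · exact ⟨b, hb, eq_zero_of_ne_one fun h' => hne (by rw [eq_one_of_ne_zero h, h'])⟩

/-- For every vertex there are two nontrivial combinations of edges that avoid it. -/
def Wide (E : Set (V → ZMod 2)) : Prop :=
  ∀ p : V, ∃ z ∈ span (ZMod 2) E, ∃ w ∈ span (ZMod 2) E, z ≠ 0 ∧ w ≠ 0 ∧ z ≠ w ∧ z p = 0 ∧ w p = 0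

theorem Wide.mono {E E' : Set (V → ZMod 2)} (h : E ⊆ E') (hE : Wide E) : Wide E' := fun p => by
  obtain ⟨z, hz, w, hw, hr⟩ := hE p
  exact ⟨z, span_mono h hz, w, span_mono h hw, hr⟩

theorem good_of_wide {E : Set (V → ZMod 2)} (hE : Wide E) {e : V → ZMod 2}
    (he : ∃ v, Covers E v ∧ e v = 1) (x : V → ZMod 2) :
    CanCross E e x := by
  obtain ⟨p, hp, hep⟩ := he
  obtain ⟨u, hu, hup⟩ := exists_add_mem_span_apply_eq_one hp x
  obtain ⟨z, hz, w, hw, hz0, hw0, hzw, hzp, hwp⟩ := hE p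
  by_contra hcon
  have key : ∀ d ∈ span (ZMod 2) E, d p = 0 →
      (∀ v, Covers E v → (u + d) v = e v) ∨ ∀ v, Covers E v → (u + d) v = 1 := by
    intro d hd hdp
    by_contra hc
    push Not at hc
    obtain ⟨⟨v, hv, hne⟩, ⟨v', hv', hne'⟩⟩ := hc
    refine hcon ⟨u + d, ?_, ⟨p, hep, by simp [hup, hdp]⟩, ⟨v, hv, hne⟩, v', hv',
      eq_zero_of_ne_one hne'⟩
    rw [← add_assoc]; exact add_mem hu hd
  have same : ∀ d d', d ∈ span (ZMod 2) E → d' ∈ span (ZMod 2) E →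
      (∀ v, Covers E v → (u + d) v = (u + d') v) → d = d' := by
    intro d d' hd hd' h
    refine sub_eq_zero.1 (eq_zero_of_covers (sub_mem hd hd') fun v hv => ?_)
    have := h v hv
    simp only [Pi.add_apply, add_right_inj] at this
    simp [this]
  have k0 := key 0 (zero_mem _) rfl
  have k1 := key z hz hzp
  have k2 := key w hw hwp
  have s1 := same 0 z (zero_mem _) hz
  have s2 := same 0 w (zero_mem _) hw
  have s3 := same z w hz hw
  rcases k0 with k0 | k0 <;> rcases k1 with k1 | k1 <;> rcases k2 with k2 | k2
  all_goals first
    | exact hz0 (s1 fun v hv => (k0 v hv).trans (k1 v hv).symm).symm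
    | exact hw0 (s2 fun v hv => (k0 v hv).trans (k2 v hv).symm).symm
    | exact hzw (s3 fun v hv => (k1 v hv).trans (k2 v hv).symm)

theorem good_of_separating {e g h x : V → ZMod 2} (hne : g ≠ e) (hg : g ≠ 0) {a b : V}
    (hea : e a = 1) (heb : e b = 1) (hgab : g a = g b) (hha : h a = 1) (hhb : h b = 0) :
    CanCross {g, e} h x := by
  have heE : e ∈ ({g, e} : Set (V → ZMod 2)) := by simp
  have hgE : g ∈ ({g, e} : Set (V → ZMod 2)) := by simp
  have ha : Covers {g, e} a := ⟨e, heE, hea⟩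
  have hb : Covers {g, e} b := ⟨e, heE, heb⟩
  obtain ⟨d, hd, hd0, hda, hdb⟩ : ∃ d ∈ span (ZMod 2) {g, e}, d ≠ 0 ∧ d a = 0 ∧ d b = 0 := by
    rcases eq_zero_or_one (g a) with h0 | h1
    · exact ⟨g, subset_span hgE, hg, h0, hgab ▸ h0⟩
    · refine ⟨g + e, add_mem (subset_span hgE) (subset_span heE), fun h => hne ?_, ?_, ?_⟩
      · rw [← add_add_self g e, h, zero_add]
      · rw [Pi.add_apply, h1, hea]; rfl
      · rw [Pi.add_apply, ← hgab, h1, heb]; rfl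
  obtain ⟨q, hdq⟩ := Function.ne_iff.1 hd0
  have hq : Covers {g, e} q := by
    by_contra hq
    exact hdq (apply_eq_zero_of_not_covers hd hq)
  replace hdq := eq_one_of_ne_zero hdq
  obtain ⟨u, hu, hua⟩ := exists_add_mem_span_apply_eq_one ha x
  have hud : x + (u + d) ∈ span (ZMod 2) {g, e} := by rw [← add_assoc]; exact add_mem hu hd
  rcases eq_zero_or_one (u b) with hub | hub
  · by_cases huq : u q = h q
    · refine ⟨u + d, hud, ⟨a, hha, by simp [hua, hda]⟩, ⟨q, hq, ?_⟩, b, hb, by simp [hub, hdb]⟩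
      simp [huq, hdq]
    · exact ⟨u, hu, ⟨a, hha, hua⟩, ⟨q, hq, huq⟩, b, hb, hub⟩
  · by_cases huq : u q = 0
    · exact ⟨u, hu, ⟨a, hha, hua⟩, ⟨b, hb, by simp [hub, hhb]⟩, q, hq, huq⟩
    · refine ⟨u + d, hud, ⟨a, hha, by simp [hua, hda]⟩, ⟨b, hb, by simp [hub, hdb, hhb]⟩, q, hq, ?_⟩
      rw [Pi.add_apply, eq_one_of_ne_zero huq, hdq]; rfl

theorem wide_of_separating {E : Set (V → ZMod 2)} {e g h : V → ZMod 2} (he : e ∈ E) (hg : g ∈ E)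
    (hh : h ∈ E) {a b c : V} (hea : e a = 1) (heb : e b = 1) (hec : e c = 1) (hgc : g c ≠ g a)
    (hgab : g a = g b) (hhab : h a ≠ h b) : Wide E := by
  have indep : ∀ r s t : ZMod 2, r • e + s • g + t • h = 0 → r = 0 ∧ s = 0 ∧ t = 0 := by
    intro r s t hr
    have h1 := congrFun hr a
    have h2 := congrFun hr b
    have h3 := congrFun hr c
    simp only [Pi.add_apply, Pi.smul_apply, Pi.zero_apply, smul_eq_mul, hea, heb, hec,
      ← hgab] at h1 h2 h3
    revert h1 h2 h3 hgc hhab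
    generalize g c = g1
    generalize g a = g2
    generalize h a = x1
    generalize h b = x2
    generalize h c = x3
    clear hr
    revert r s t g1 g2 x1 x2 x3
    decide
  intro p
  have comb : ∀ a b c : ZMod 2, ∃ r s t r' s' t' : ZMod 2, (r ≠ 0 ∨ s ≠ 0 ∨ t ≠ 0) ∧
      (r' ≠ 0 ∨ s' ≠ 0 ∨ t' ≠ 0) ∧ (r - r' ≠ 0 ∨ s - s' ≠ 0 ∨ t - t' ≠ 0) ∧
      r * a + s * b + t * c = 0 ∧ r' * a + s' * b + t' * c = 0 := by decide
  obtain ⟨r, s, t, r', s', t', h1, h2, h3, h4, h5⟩ := comb (e p) (g p) (h p)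
  have mem : ∀ r s t : ZMod 2, r • e + s • g + t • h ∈ span (ZMod 2) E := fun r s t =>
    add_mem (add_mem (smul_mem _ _ (subset_span he)) (smul_mem _ _ (subset_span hg)))
      (smul_mem _ _ (subset_span hh))
  refine ⟨_, mem r s t, _, mem r' s' t', fun h0 => ?_, fun h0 => ?_, fun h0 => ?_, h4, h5⟩
  · have := indep r s t h0
    tauto
  · have := indep r' s' t' h0
    tauto
  · have := indep (r - r') (s - s') (t - t') (by
      rw [sub_smul, sub_smul, sub_smul, ← sub_eq_zero.2 h0]; abel)
    tauto

theorem Connected.covers {E : Set (V → ZMod 2)} (hc : Connected E) {u : V} (hu : Covers E u)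
    (v : V) : Covers E v := by
  rcases (hc v u).cases_head with rfl | ⟨w, ⟨e, he, hv, -⟩, -⟩
  · exact hu
  · exact ⟨e, he, hv⟩

/-- A connected set of edges is exhausted by adding edges that meet those already present. -/
theorem Connected.exists_meeting_edge {E E' : Set (V → ZMod 2)} (hc : Connected E)
    (h0 : ∀ e ∈ E, e ≠ 0) {a : V} (ha : Covers E' a) (hne : ∃ e ∈ E, e ∉ E') :
    ∃ e ∈ E, e ∉ E' ∧ ∃ v, Covers E' v ∧ e v = 1 := by
  by_contra hcon
  push Not at hcon
  have all : ∀ v, Covers E' v := by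
    intro v
    have := hc a v
    induction this with
    | refl => exact ha
    | @tail b c _ hbc ih =>
      obtain ⟨e, he, heb, hec⟩ := hbc
      by_cases heE : e ∈ E'
      · exact ⟨e, heE, hec⟩
      · exact absurd heb (hcon e he heE b ih)
  obtain ⟨e, he, heE⟩ := hne
  obtain ⟨v, hv⟩ := Function.ne_iff.1 (h0 e he)
  exact hcon e he heE v (all v) (eq_one_of_ne_zero hv)

theorem Controls.extend [Finite V] {K : (V → ZMod 2) → Prop} {E E₀ : Set (V → ZMod 2)}
    (hc : Connected E) (h0 : ∀ e ∈ E, e ≠ 0)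
    (hK : ∀ x, K x → ∀ z ∈ span (ZMod 2) E, K (x + z)) (hE₀ : E₀ ⊆ E) {a : V} (ha : Covers E₀ a)
    (h : Controls K E₀)
    (good : ∀ E', E₀ ⊆ E' → E' ⊆ E → ∀ e ∈ E, (∃ v, Covers E' v ∧ e v = 1) → ∀ x, K x →
      CanCross E' e x) : Controls K E := by
  obtain ⟨M, hM⟩ := (Set.toFinite {E' | E₀ ⊆ E' ∧ E' ⊆ E ∧ Controls K E'}).exists_maximal
    ⟨E₀, subset_rfl, hE₀, h⟩
  obtain ⟨⟨h1, h2, h3⟩, hmax⟩ := hM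
  by_cases hne : ∃ e ∈ E, e ∉ M
  · exfalso
    obtain ⟨e, he, heM, hmeet⟩ := hc.exists_meeting_edge h0 (ha.mono h1) hne
    have hins : insert e M ⊆ E := Set.insert_subset he h2
    refine heM (hmax ⟨h1.trans (Set.subset_insert _ _), hins, ?_⟩ (Set.subset_insert e M)
      (Set.mem_insert e M))
    exact h3.insert_of_good (fun x hx z hz => hK x hx z (span_mono hins hz)) hmeet
      (good M h1 h2 e he hmeet)
  · push Not at hne
    rwa [subset_antisymm h2 hne] at h3

theorem controls_of_twins [Finite V] {E : Set (V → ZMod 2)} (hc : Connected E)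
    (h0 : ∀ e ∈ E, e ≠ 0) {a b : V} (hab : Twin E a b) (ha : Covers E a) :
    Controls (fun x => x a ≠ x b) E := by
  obtain ⟨e, he, hea⟩ := ha
  refine Controls.extend hc h0 (fun x hx z hz => ?_) (Set.singleton_subset_iff.2 he)
    ⟨e, rfl, hea⟩ (controls_singleton _ e) fun E' h1 h2 f hf hmeet x hx =>
      good_of_twins hmeet ⟨e, h1 rfl, hea⟩ (fun g hg => hab g (h2 hg)) (hab f hf) hx
  simp only [Pi.add_apply, hab.eq_of_mem_span hz]
  simpa using hx

/-- Some edge has three vertices that are pairwise distinguished by the edges. -/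
def Thick (E : Set (V → ZMod 2)) : Prop :=
  ∃ e ∈ E, ∃ a b c, e a = 1 ∧ e b = 1 ∧ e c = 1 ∧ ¬ Twin E a b ∧ ¬ Twin E b c ∧ ¬ Twin E a c

theorem Twin.symm {E : Set (V → ZMod 2)} {u v : V} (h : Twin E u v) : Twin E v u :=
  fun e he => (h e he).symm

theorem Twin.trans {E : Set (V → ZMod 2)} {u v w : V} (h : Twin E u v) (h' : Twin E v w) :
    Twin E u w :=
  fun e he => (h e he).trans (h' e he)

theorem Thick.exists_separating {E : Set (V → ZMod 2)} (h : Thick E) :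
    ∃ e ∈ E, ∃ g ∈ E, ∃ k ∈ E, ∃ a b c, e a = 1 ∧ e b = 1 ∧ e c = 1 ∧ g c ≠ g a ∧ g a = g b ∧
      k a = 1 ∧ k b = 0 := by
  obtain ⟨e, he, a, b, c, ha, hb, hc, hab, hbc, hac⟩ := h
  have main : ∀ a b c, e a = 1 → e b = 1 → e c = 1 → ¬ Twin E a b → ∀ g ∈ E, g c ≠ g a →
      g a = g b → ∃ e ∈ E, ∃ g ∈ E, ∃ k ∈ E, ∃ a b c, e a = 1 ∧ e b = 1 ∧ e c = 1 ∧ g c ≠ g a ∧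
        g a = g b ∧ k a = 1 ∧ k b = 0 := by
    intro a b c ha hb hc hab g hg h1 h2
    unfold Twin at hab
    push Not at hab
    obtain ⟨k, hk, hne⟩ := hab
    rcases eq_zero_or_one (k a) with h | h
    · exact ⟨e, he, g, hg, k, hk, b, a, c, hb, ha, hc, h2 ▸ h1, h2.symm,
        eq_one_of_ne_zero fun h' => hne (by rw [h, h']), h⟩
    · exact ⟨e, he, g, hg, k, hk, a, b, c, ha, hb, hc, h1, h2, h,
        eq_zero_of_ne_one fun h' => hne (by rw [h, h'])⟩
  have hac' := hac
  unfold Twin at hac'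
  push Not at hac'
  obtain ⟨g, hg, hne⟩ := hac'
  by_cases h : g a = g b
  · exact main a b c ha hb hc hab g hg hne.symm h
  · refine main b c a hb hc ha hbc g hg h ?_
    revert hne h
    generalize g a = x
    generalize g b = y
    generalize g c = z
    revert x y z
    decide

theorem Thick.controls [Finite V] {E : Set (V → ZMod 2)} (h : Thick E) (hc : Connected E)
    (h0 : ∀ e ∈ E, e ≠ 0) : Controls (fun _ => True) E := by
  obtain ⟨e, he, g, hg, k, hk, a, b, c, hea, heb, hec, hgc, hgab, hka, hkb⟩ := h.exists_separating
  have hsub : ({k, g, e} : Set (V → ZMod 2)) ⊆ E := by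
    rintro f (rfl | rfl | rfl) <;> assumption
  have hwide : Wide ({k, g, e} : Set (V → ZMod 2)) :=
    wide_of_separating (e := e) (g := g) (h := k) (by simp) (by simp) (by simp) hea heb hec hgc hgab
      (by rw [hka, hkb]; decide)
  have hge : g ≠ e := by
    rintro rfl
    exact hgc (by rw [hea, hec])
  have hpair : Controls (fun _ => True) {g, e} := by
    rcases eq_zero_or_one (g a) with h | h
    · exact controls_pair e g hec (eq_one_of_ne_zero fun h' => hgc (by rw [h, h']))
    · exact controls_pair e g hea h
  have htriple : Controls (fun _ => True) {k, g, e} :=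
    hpair.insert_of_good (fun _ _ _ _ => trivial) ⟨a, ⟨e, by simp, hea⟩, hka⟩
      fun x _ => good_of_separating hge (h0 g hg) hea heb hgab hka hkb
  exact Controls.extend hc h0 (fun _ _ _ _ => trivial) hsub ⟨e, by simp, hea⟩ htriple
    fun E' h1 _ f _ hmeet x _ => good_of_wide (hwide.mono h1) hmeet x

end VectorSwitching

namespace VectorSwitching

open Relation Submodule

variable {V : Type}

/-! ### Edges that consist of at most two classes of twins -/

def twinSetoid (E : Set (V → ZMod 2)) : Setoid V :=
  ⟨Twin E, fun _ _ _ => rfl, Twin.symm, Twin.trans⟩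

/-- A representative of the class of `v`. -/
noncomputable def rep (E : Set (V → ZMod 2)) (v : V) : V :=
  (Quotient.mk (twinSetoid E) v).out

theorem twin_rep (E : Set (V → ZMod 2)) (v : V) : Twin E (rep E v) v :=
  Quotient.exact (s := twinSetoid E) (Quotient.out_eq _)

theorem Twin.rep_eq {E : Set (V → ZMod 2)} {u v : V} (h : Twin E u v) : rep E u = rep E v :=
  congrArg Quotient.out (Quotient.sound (s := twinSetoid E) h)

theorem twin_iff_eq_rep {E : Set (V → ZMod 2)} {a v : V} (hv : rep E v = v) :
    Twin E a v ↔ v = rep E a :=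
  ⟨fun h => by rw [h.rep_eq, hv], fun h => h ▸ (twin_rep E a).symm⟩

open Classical in
/-- The configuration with balls at the twins of `a`. -/
noncomputable def twinClass (E : Set (V → ZMod 2)) (a : V) : V → ZMod 2 :=
  fun v => if Twin E a v then 1 else 0

theorem twinClass_self (E : Set (V → ZMod 2)) (a : V) : twinClass E a a = 1 :=
  if_pos fun _ _ => rfl

theorem twinClass_eq_one {E : Set (V → ZMod 2)} {a v : V} : twinClass E a v = 1 ↔ Twin E a v := by
  by_cases h : Twin E a v <;> simp [twinClass, h]

theorem Twin.twinClass_eq {E : Set (V → ZMod 2)} {a b : V} (h : Twin E a b) :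
    twinClass E a = twinClass E b := by
  funext v
  by_cases hv : Twin E a v
  · rw [twinClass_eq_one.2 hv, twinClass_eq_one.2 (h.symm.trans hv)]
  · rw [eq_zero_of_ne_one fun h' => hv (twinClass_eq_one.1 h'),
      eq_zero_of_ne_one fun h' => hv (h.trans (twinClass_eq_one.1 h'))]

theorem eq_twinClass {E : Set (V → ZMod 2)} {z : V → ZMod 2} {a : V}
    (hz : ∀ u v, Twin E u v → z u = z v) (ha : z a = 1) (h : ∀ v, z v = 1 → Twin E a v) :
    z = twinClass E a := by
  funext v
  by_cases hv : Twin E a v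
  · rw [twinClass_eq_one.2 hv, ← hz a v hv, ha]
  · rw [eq_zero_of_ne_one fun h' => hv (h v h'),
      eq_zero_of_ne_one fun h' => hv (twinClass_eq_one.1 h')]

theorem eq_twinClass_add_twinClass {E : Set (V → ZMod 2)} (hE : ¬ Thick E) {e : V → ZMod 2}
    (he : e ∈ E) {a b : V} (ha : e a = 1) (hb : e b = 1) (hab : ¬ Twin E a b) :
    e = twinClass E a + twinClass E b := by
  funext v
  rw [Pi.add_apply]
  by_cases hav : Twin E a v
  · rw [twinClass_eq_one.2 hav, eq_zero_of_ne_one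
      fun h' => hab (hav.trans (twinClass_eq_one.1 h').symm), ← hav e he, ha]; rfl
  · rw [eq_zero_of_ne_one fun h' => hav (twinClass_eq_one.1 h'), zero_add]
    by_cases hbv : Twin E b v
    · rw [twinClass_eq_one.2 hbv, ← hbv e he, hb]
    · rw [eq_zero_of_ne_one fun h' => hbv (twinClass_eq_one.1 h')]
      exact eq_zero_of_ne_one fun h' => hE ⟨e, he, a, b, v, ha, hb, h', hab, hbv, hav⟩

/-- The vertices that represent the classes on which `z` has balls. -/
noncomputable def ballReps [Fintype V] (E : Set (V → ZMod 2)) (z : V → ZMod 2) : Finset V :=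
  open Classical in Finset.univ.filter fun v => rep E v = v ∧ z v = 1

theorem mem_ballReps [Fintype V] {E : Set (V → ZMod 2)} {z : V → ZMod 2} {v : V} :
    v ∈ ballReps E z ↔ rep E v = v ∧ z v = 1 := by
  simp [ballReps]

theorem Reach.apply_eq {E : Set (V → ZMod 2)} {x y : V → ZMod 2} (h : Reach E x y)
    (hx : ∀ u v, Twin E u v → x u = x v) : ∀ u v, Twin E u v → y u = y v := by
  intro u v huv
  have h1 := huv.eq_of_mem_span h.add_mem_span
  simpa [hx u v huv] using h1

theorem Connected.exists_reach_fewer [Fintype V] {E : Set (V → ZMod 2)} (hE : ¬ Thick E)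
    (hc : Connected E) {z : V → ZMod 2} (hz : ∀ u v, Twin E u v → z u = z v) {a b : V}
    (ha : z a = 1) (hb : z b = 1) (hab : ¬ Twin E a b) :
    ∃ z', Reach E z z' ∧ (ballReps E z').card < (ballReps E z).card := by
  classical
  have hchain := hc a b
  induction hchain using ReflTransGen.head_induction_on generalizing z with
  | refl => exact absurd (fun _ _ => rfl) hab
  | @head a c hac _ ih =>
    obtain ⟨e, he, hea, hec⟩ := hac
    by_cases hT : Twin E a c
    · exact ih hz (hz a c hT ▸ ha) hb fun h => hab (hT.trans h)
    · have hsum := eq_twinClass_add_twinClass hE he hea hec hT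
      have hr := reach_of_meets he hea ha
      have hrepa : rep E a ∈ ballReps E z :=
        mem_ballReps.2 ⟨(twin_rep E a).rep_eq, by rw [hz _ _ (twin_rep E a), ha]⟩
      by_cases hzc : z c = 1
      · refine ⟨z + e, hr, Finset.card_lt_card ((Finset.ssubset_iff_of_subset fun v hv => ?_).2
          ⟨rep E a, hrepa, fun h => ?_⟩)⟩
        · obtain ⟨hv1, hv2⟩ := mem_ballReps.1 hv
          refine mem_ballReps.2 ⟨hv1, ?_⟩
          by_contra hzv
          rw [Pi.add_apply, eq_zero_of_ne_one hzv, zero_add, hsum, Pi.add_apply] at hv2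
          have h1 : twinClass E a v = 0 := eq_zero_of_ne_one fun h' =>
            hzv (by rw [← hz _ _ (twinClass_eq_one.1 h'), ha])
          have h2 : twinClass E c v = 0 := eq_zero_of_ne_one fun h' =>
            hzv (by rw [← hz _ _ (twinClass_eq_one.1 h'), hzc])
          rw [h1, h2] at hv2
          exact absurd hv2 (by decide)
        · have := (mem_ballReps.1 h).2
          rw [Pi.add_apply, hz _ _ (twin_rep E a), ha, twin_rep E a e he, hea] at this
          exact absurd this (by decide)
      · replace hzc := eq_zero_of_ne_one hzc
        obtain ⟨z', hz', hlt⟩ := ih (z := z + e) (hr.apply_eq hz) (by simp [hzc, hec])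
          (by
            have : e b = 0 := eq_zero_of_ne_one fun h' => by
              rw [hsum, Pi.add_apply, eq_zero_of_ne_one fun h => hab (twinClass_eq_one.1 h),
                zero_add, twinClass_eq_one] at h'
              rw [hz _ _ h', hb] at hzc
              exact absurd hzc (by decide)
            rw [Pi.add_apply, hb, this, add_zero])
          (fun h => by
            rw [hz _ _ h, hb] at hzc
            exact absurd hzc (by decide))
        refine ⟨z', hr.trans hz', hlt.trans_le ?_⟩
        calc (ballReps E (z + e)).card
            ≤ (insert (rep E c) ((ballReps E z).erase (rep E a))).card := by
              refine Finset.card_le_card fun v hv => ?_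
              obtain ⟨hv1, hv2⟩ := mem_ballReps.1 hv
              rw [Finset.mem_insert, Finset.mem_erase, mem_ballReps]
              by_cases hvc : Twin E c v
              · exact .inl ((twin_iff_eq_rep hv1).1 hvc)
              by_cases hva : Twin E a v
              · rw [Pi.add_apply, ← hz _ _ hva, ha, ← hva e he, hea] at hv2
                exact absurd hv2 (by decide)
              right
              refine ⟨fun h => hva ((twin_iff_eq_rep hv1).2 h), hv1, ?_⟩
              rwa [hsum, Pi.add_apply, Pi.add_apply,
                eq_zero_of_ne_one fun h => hva (twinClass_eq_one.1 h),
                eq_zero_of_ne_one fun h => hvc (twinClass_eq_one.1 h), add_zero, add_zero] at hv2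
          _ ≤ ((ballReps E z).erase (rep E a)).card + 1 := Finset.card_insert_le _ _
          _ = (ballReps E z).card := Finset.card_erase_add_one hrepa

theorem Connected.exists_reach_twinClass [Fintype V] {E : Set (V → ZMod 2)} (hE : ¬ Thick E)
    (hc : Connected E) {z : V → ZMod 2} (hz : ∀ u v, Twin E u v → z u = z v) :
    ∃ z', Reach E z z' ∧ (z' = 0 ∨ ∃ a, z' = twinClass E a) := by
  induction hn : (ballReps E z).card using Nat.strong_induction_on generalizing z with
  | _ n ih =>
    by_cases hp : ∃ a b, z a = 1 ∧ z b = 1 ∧ ¬ Twin E a b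
    · obtain ⟨a, b, ha, hb, hab⟩ := hp
      obtain ⟨z', hr, hlt⟩ := hc.exists_reach_fewer hE hz ha hb hab
      obtain ⟨z'', hr', h⟩ := ih _ (hn ▸ hlt) (hr.apply_eq hz) rfl
      exact ⟨z'', hr.trans hr', h⟩
    · push Not at hp
      refine ⟨z, .refl, ?_⟩
      by_cases h0 : z = 0
      · exact .inl h0
      · obtain ⟨a, ha⟩ := Function.ne_iff.1 h0
        have ha' := eq_one_of_ne_zero ha
        exact .inr ⟨a, eq_twinClass hz ha' fun v hv => hp a v ha' hv⟩

theorem Connected.reach_twinClass {E : Set (V → ZMod 2)} (hE : ¬ Thick E) (hc : Connected E)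
    (a b : V) : Reach E (twinClass E a) (twinClass E b) := by
  have hchain := hc a b
  induction hchain using ReflTransGen.head_induction_on with
  | refl => exact .refl
  | @head a c hac _ ih =>
    obtain ⟨e, he, hea, hec⟩ := hac
    by_cases hT : Twin E a c
    · rwa [hT.twinClass_eq]
    · have := reach_of_meets he hea (twinClass_self E a)
      rw [eq_twinClass_add_twinClass hE he hea hec hT, self_add_add] at this
      exact this.trans ih

open Classical in
theorem exists_twinClass_mem [Fintype V] {E : Set (V → ZMod 2)} (hE : ¬ Thick E)
    (h0 : ∀ e ∈ E, e ≠ 0) {a : V} (ha : twinClass E a ∈ span (ZMod 2) E) :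
    ∃ b, twinClass E b ∈ E := by
  by_contra hcon
  push Not at hcon
  let φ : (V → ZMod 2) → ZMod 2 := fun z => ∑ v, if rep E v = v then z v else 0
  have hadd : ∀ x y, φ (x + y) = φ x + φ y := fun x y => by
    simp only [φ, ← Finset.sum_add_distrib]
    refine Finset.sum_congr rfl fun v _ => ?_
    split_ifs <;> simp
  have hclass : ∀ a, φ (twinClass E a) = 1 := fun a => by
    have : ∀ v, (if rep E v = v then twinClass E a v else 0) = if v = rep E a then 1 else 0 := by
      intro v
      by_cases hv : rep E v = v
      · simp only [hv, if_true, twinClass, twin_iff_eq_rep hv]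
      · rw [if_neg hv, if_neg]
        rintro rfl
        exact hv (twin_rep E a).rep_eq
    simp only [φ, this, Finset.sum_ite_eq', Finset.mem_univ, if_true]
  have hspan : ∀ z ∈ span (ZMod 2) E, φ z = 0 := by
    intro z hz
    induction hz using span_induction with
    | mem e he =>
      obtain ⟨b, hb⟩ := Function.ne_iff.1 (h0 e he)
      replace hb := eq_one_of_ne_zero hb
      by_cases hall : ∀ v, e v = 1 → Twin E b v
      · exact absurd (eq_twinClass (fun u v h => h e he) hb hall ▸ he) (hcon b)
      · push Not at hall
        obtain ⟨v, hv, hbv⟩ := hall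
        rw [eq_twinClass_add_twinClass hE he hb hv hbv, hadd, hclass, hclass]; rfl
    | zero => simp [φ]
    | add x y _ _ hx hy => rw [hadd, hx, hy, add_zero]
    | smul c x _ hx =>
      rcases eq_zero_or_one c with rfl | rfl
      · simp [φ]
      · rwa [one_smul]
  have := hspan _ ha
  rw [hclass] at this
  exact absurd this (by decide)

/-! ### Recurrent configurations -/

/-- `x` differs on two vertices that are not distinguished by the edges. -/
def SplitsTwins (E : Set (V → ZMod 2)) (x : V → ZMod 2) : Prop :=
  ∃ u v, Twin E u v ∧ x u ≠ x v

theorem Connected.reach_zero [Fintype V] {E : Set (V → ZMod 2)} (hc : Connected E)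
    (h0 : ∀ e ∈ E, e ≠ 0) {x : V → ZMod 2} (hx : x ∈ span (ZMod 2) E) : Reach E x 0 := by
  by_cases hx0 : x = 0
  · rw [hx0]; exact .refl
  by_cases hE : Thick E
  · obtain ⟨v, hv⟩ := Function.ne_iff.1 hx0
    have hcov : Covers E v := by
      by_contra h
      exact hv (apply_eq_zero_of_not_covers hx h)
    exact hE.controls hc h0 x 0 trivial (by rwa [add_zero]) ⟨v, hcov, eq_one_of_ne_zero hv⟩
      ⟨v, hcov, rfl⟩
  · obtain ⟨z, hr, rfl | ⟨a, rfl⟩⟩ := hc.exists_reach_twinClass hE fun u v h => h.eq_of_mem_span hx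
    · exact hr
    · have ha : twinClass E a ∈ span (ZMod 2) E := by
        have := add_mem hx hr.add_mem_span
        rwa [self_add_add] at this
      obtain ⟨b, hb⟩ := exists_twinClass_mem hE h0 ha
      have := reach_of_meets hb (twinClass_self E b) (twinClass_self E b)
      rw [ZModModule.add_self] at this
      exact (hr.trans (hc.reach_twinClass hE a b)).trans this

theorem eq_zero_of_reach {E : Set (V → ZMod 2)} {s : V → ZMod 2} (h : Reach E 0 s) : s = 0 := by
  rcases h.cases_head with h | ⟨y, ⟨e, -, ⟨v, -, hv⟩, -⟩, -⟩
  · exact h.symm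
  · exact absurd hv zero_ne_one

theorem Reach.mem_span_iff {E : Set (V → ZMod 2)} {x z : V → ZMod 2} (h : Reach E x z) :
    z ∈ span (ZMod 2) E ↔ x ∈ span (ZMod 2) E := by
  have := h.add_mem_span
  constructor
  · intro hz
    simpa [add_add_self] using add_mem this hz
  · intro hx
    have := add_mem hx this
    rwa [self_add_add] at this

/-- Balls of `s` are only at one class of twins. -/
def OnTwins (E : Set (V → ZMod 2)) (s : V → ZMod 2) : Prop :=
  ∀ u v, s u = 1 → s v = 1 → Twin E u v

theorem Connected.recurrent_iff_of_mem [Fintype V] {E : Set (V → ZMod 2)} (hc : Connected E)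
    (h0 : ∀ e ∈ E, e ≠ 0) {x : V → ZMod 2} (hx : x ∈ span (ZMod 2) E) (s : V → ZMod 2) :
    (∀ z, Reach E x z → Reach E z s) ↔ s = 0 := by
  constructor
  · exact fun h => eq_zero_of_reach (h 0 (hc.reach_zero h0 hx))
  · rintro rfl z hz
    exact hc.reach_zero h0 (hz.mem_span_iff.2 hx)

theorem Connected.recurrent_iff_of_not_mem [Fintype V] {E : Set (V → ZMod 2)} (hc : Connected E)
    (h0 : ∀ e ∈ E, e ≠ 0) {x : V → ZMod 2} (hx : x ∉ span (ZMod 2) E) (s : V → ZMod 2) :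
    (∀ z, Reach E x z → Reach E z s) ↔ x + s ∈ span (ZMod 2) E ∧
      (SplitsTwins E x ∨ (Thick E ∧ s ≠ 1) ∨ OnTwins E s) := by
  have key : x + s ∈ span (ZMod 2) E → ∀ z, Reach E x z → z + s ∈ span (ZMod 2) E := by
    intro h z hz
    have := add_mem hz.add_mem_span h
    rwa [show x + z + (x + s) = x + (x + (z + s)) by abel, self_add_add] at this
  by_cases hsplit : SplitsTwins E x
  · simp only [hsplit, true_or, and_true]
    refine ⟨fun h => (h x .refl).add_mem_span, fun h z hz => ?_⟩
    obtain ⟨u, v, huv, hne⟩ := hsplit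
    have hEne : ∃ e, e ∈ E := by
      by_contra hE
      push Not at hE
      rcases (hc u v).cases_head with rfl | ⟨w, ⟨e, he, -⟩, -⟩
      · exact hne rfl
      · exact hE e he
    obtain ⟨e, he⟩ := hEne
    obtain ⟨p, hp⟩ := Function.ne_iff.1 (h0 e he)
    have hcov := hc.covers ⟨e, he, eq_one_of_ne_zero hp⟩
    have differ : ∀ y, x + y ∈ span (ZMod 2) E → y u ≠ y v := by
      intro y hy
      have := huv.eq_of_mem_span hy
      simp only [Pi.add_apply] at this
      intro h'
      rw [h', add_left_inj] at this
      exact hne this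
    refine controls_of_twins hc h0 huv (hcov u) z s (differ z hz.add_mem_span) (key h z hz) ?_ ?_
    · have := differ z hz.add_mem_span
      by_cases hu : z u = 1
      · exact ⟨u, hcov u, hu⟩
      · exact ⟨v, hcov v, eq_one_of_ne_zero fun hv => this (by rw [eq_zero_of_ne_one hu, hv])⟩
    · have := differ s h
      by_cases hu : s u = 0
      · exact ⟨u, hcov u, hu⟩
      · exact ⟨v, hcov v, eq_zero_of_ne_one fun hv => this (by rw [eq_one_of_ne_zero hu, hv])⟩
  have hconst : ∀ u v, Twin E u v → x u = x v := by
    intro u v huv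
    by_contra hne
    exact hsplit ⟨u, v, huv, hne⟩
  by_cases hE : Thick E
  · have hE' := hE
    obtain ⟨e, he, a, b, c, hea, heb, hec, hab, -, -⟩ := hE'
    have hon : OnTwins E s → s ≠ 1 := by
      rintro h rfl
      exact hab (h a b rfl rfl)
    simp only [hE, hsplit, true_and, false_or, or_iff_left_of_imp hon]
    refine ⟨fun h => ⟨(h x .refl).add_mem_span, ?_⟩, fun ⟨h, hs⟩ z hz => ?_⟩
    · rintro rfl
      have only : ∀ z, Reach E z 1 → z = 1 := by
        intro z hz
        rcases hz.cases_tail with h | ⟨y, -, ⟨f, -, ⟨v, hfv, hyv⟩, hy⟩⟩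
        · exact h.symm
        · have := congrFun hy v
          rw [Pi.add_apply, hfv, hyv, Pi.one_apply] at this
          exact absurd this (by decide)
      have hx1 := only x (h x .refl)
      have hr := reach_of_meets (x := x) he hea (by rw [hx1]; rfl)
      have := congrFun (only _ (h _ hr)) a
      rw [Pi.add_apply, hx1, hea, Pi.one_apply] at this
      exact absurd this (by decide)
    · obtain ⟨v, hv⟩ := Function.ne_iff.1 hs
      have hcov := hc.covers ⟨e, he, hea⟩
      have hz0 : z ≠ 0 := by
        rintro rfl
        exact hx (hz.mem_span_iff.1 (zero_mem _))
      obtain ⟨w, hw⟩ := Function.ne_iff.1 hz0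
      exact hE.controls hc h0 z s trivial (key h z hz) ⟨w, hcov w, eq_one_of_ne_zero hw⟩
        ⟨v, hcov v, eq_zero_of_ne_one hv⟩
  · simp only [hE, hsplit, false_and, false_or]
    have reduce : ∀ z, Reach E x z → ∃ a, Reach E z (twinClass E a) := by
      intro z hz
      obtain ⟨z', hr, rfl | ⟨a, rfl⟩⟩ := hc.exists_reach_twinClass hE (hz.apply_eq hconst)
      · exact absurd ((Reach.mem_span_iff (hz.trans hr)).1 (zero_mem _)) hx
      · exact ⟨a, hr⟩
    constructor
    · intro h
      refine ⟨(h x .refl).add_mem_span, ?_⟩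
      obtain ⟨a, ha⟩ := reduce x .refl
      have hs := h _ ha
      have closed : ∃ b, s = twinClass E b := by
        clear h key
        induction hs with
        | refl => exact ⟨a, rfl⟩
        | @tail y t hay hm ih =>
          obtain ⟨b, rfl⟩ := ih
          obtain ⟨e, he, ⟨v, hev, hbv⟩, rfl⟩ := hm
          rw [twinClass_eq_one] at hbv
          have heb : e b = 1 := by rw [hbv e he, hev]
          by_cases hall : ∀ v, e v = 1 → Twin E b v
          · exfalso
            have heq := eq_twinClass (fun u v h => h e he) heb hall
            exact hx ((Reach.mem_span_iff (ha.trans hay)).1 (heq ▸ subset_span he))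
          · push Not at hall
            obtain ⟨c, hec, hbc⟩ := hall
            exact ⟨c, by rw [eq_twinClass_add_twinClass hE he heb hec hbc, self_add_add]⟩
      obtain ⟨b, rfl⟩ := closed
      intro u v hu hv
      exact (twinClass_eq_one.1 hu).symm.trans (twinClass_eq_one.1 hv)
    · rintro ⟨h, hs⟩ z hz
      have hs0 : s ≠ 0 := by
        rintro rfl
        exact hx (by rwa [add_zero] at h)
      obtain ⟨b, hb⟩ := Function.ne_iff.1 hs0
      replace hb := eq_one_of_ne_zero hb
      have hsc : ∀ u v, Twin E u v → s u = s v := by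
        intro u v huv
        have := huv.eq_of_mem_span h
        simpa [hconst u v huv] using this
      obtain ⟨a, ha⟩ := reduce z hz
      rw [eq_twinClass hsc hb fun v hv => hs b v hb hv]
      exact ha.trans (hc.reach_twinClass hE a b)

end VectorSwitching

/-! ### Translation to hypergraphs -/

namespace HyperedgeSwitching

open Relation VectorSwitching

variable {V : Type}

/-- `s` is recurrent if and only if it is reachable from all reachable configurations. -/
theorem isRecurrent_iff (H : Hypergraph V) (w s : V → ZMod 2) :
    IsRecurrent H w s ↔ ∀ z, Reachable H w z → Reachable H z s := by
  classical
  constructor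
  · intro h z hz
    let next : (V → ZMod 2) → V → ZMod 2 := fun x => if hx : ∃ y, Step H x y then hx.choose else x
    have start : ∃ π, IsPath H π ∧ π 0 = z := by
      refine ⟨fun t => next^[t] z, fun t => ?_, rfl⟩
      simp only [Function.iterate_succ_apply']
      generalize next^[t] z = x
      by_cases hx : ∃ y, Step H x y
      · left
        simp only [next, dif_pos hx]
        exact hx.choose_spec
      · right
        simp only [next, dif_neg hx, and_true]
        exact fun y hy => hx ⟨y, hy⟩
    have reach : ∃ π t, IsPath H π ∧ π 0 = w ∧ π t = z := by
      induction hz using ReflTransGen.head_induction_on with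
      | refl =>
        obtain ⟨π, hπ, h0⟩ := start
        exact ⟨π, 0, hπ, h0, h0⟩
      | @head a b hab _ ih =>
        obtain ⟨π, t, hπ, h0, ht⟩ := ih (fun π hπ hb t => by
          have := h (fun k => Nat.casesOn k a π) (fun k => by
            cases k with
            | zero => left; simpa [hb] using hab
            | succ k => exact hπ k) rfl (t + 1)
          exact this)
        refine ⟨fun k => Nat.casesOn k a π, t + 1, fun k => ?_, rfl, ht⟩
        cases k with
        | zero => left; simpa [h0] using hab
        | succ k => exact hπ k
    obtain ⟨π, t, hπ, h0, rfl⟩ := reach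
    exact h π hπ h0 t
  · intro h π hπ h0 t
    refine h _ ?_
    induction t with
    | zero => rw [h0]; exact .refl
    | succ t ih =>
      rcases hπ t with hs | ⟨-, hs⟩
      · exact ih.tail hs
      · rwa [hs]

open Classical in
/-- The indicator vectors of the hyperedges. -/
noncomputable def edgeVectors (H : Hypergraph V) : Set (V → ZMod 2) :=
  {x | ∃ l ∈ H.edgeSet, x = fun v => if v ∈ l then 1 else 0}

theorem reachable_iff (H : Hypergraph V) (x y : V → ZMod 2) :
    Reachable H x y ↔ Reach (edgeVectors H) x y := by
  classical
  have hstep : Step H = Move (edgeVectors H) := by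
    funext x y
    refine propext ⟨?_, ?_⟩
    · rintro ⟨l, hl, ⟨v, hv, hx⟩, rfl⟩
      refine ⟨_, ⟨l, hl, rfl⟩, ⟨v, if_pos hv, hx⟩, ?_⟩
      funext u
      by_cases hu : u ∈ l <;> simp [switch, hu, add_comm]
    · rintro ⟨e, ⟨l, hl, rfl⟩, ⟨v, hv, hx⟩, rfl⟩
      refine ⟨l, hl, ⟨v, by_contra fun h => ?_, hx⟩, ?_⟩
      · simp [h] at hv
      · funext u
        by_cases hu : u ∈ l <;> simp [switch, hu, add_comm]
  rw [Reachable, hstep, Reach]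

theorem IsConnected.connected {H : Hypergraph V} (hH : IsConnected H)
    (huniv : H.vertexSet = Set.univ) :
    Connected (edgeVectors H) := by
  classical
  intro u v
  refine ReflTransGen.mono (r := H.Adj) ?_ _ _ (hH u (by simp [huniv]) v (by simp [huniv]))
  rintro a b ⟨l, hl, ha, hb⟩
  exact ⟨_, ⟨l, hl, rfl⟩, if_pos ha, if_pos hb⟩

theorem NoGraphEdges.ne_zero {H : Hypergraph V} (hH : NoGraphEdges H) :
    ∀ e ∈ edgeVectors H, e ≠ 0 := by
  classical
  rintro e ⟨l, hl, rfl⟩ h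
  have hne : l.Nonempty := by
    rw [← Set.encard_ne_zero]
    intro h0
    have := hH l hl
    simp [h0] at this
  obtain ⟨v, hv⟩ := hne
  have := congrFun h v
  simp [hv] at this

end HyperedgeSwitching

/-! ### Boolean expressions and matrices in memory -/

namespace RAM

open Finset

namespace NatExpr

def land (a b : NatExpr) : NatExpr := .ite a b (.lit 0)
def lor (a b : NatExpr) : NatExpr := .ite a (.lit 1) b
def lnot (a : NatExpr) : NatExpr := .ite a (.lit 0) (.lit 1)
def lt (a b : NatExpr) : NatExpr := .sub b a
def absDiff (a b : NatExpr) : NatExpr := .add (.sub a b) (.sub b a)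
def eq (a b : NatExpr) : NatExpr := lnot (absDiff a b)

/-- Some value of register `x` below register `y` satisfies `b`. -/
def ex (x y : ℕ) (b : NatExpr) : NatExpr := .sum x (land (lt (.var x) (.var y)) b)
def all (x y : ℕ) (b : NatExpr) : NatExpr := lnot (ex x y (lnot b))

/-- The address of the entry in row `k` and column `l` of the matrix stored from address `2` on,
whose number of columns is in register `1`.  Register `20` is a scratch register. -/
def addr (k l : NatExpr) : NatExpr :=
  .add (.add (.lit 2) (.sum 20 (.ite (lt (.var 20) k) (.var 1) (.lit 0)))) l

def entry (k l : NatExpr) : NatExpr := .mem (addr k l)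

def Holds (e : NatExpr) (s : State) : Prop := e.eval s ≠ 0

variable {a b : NatExpr} {s : State}

theorem holds_land : (land a b).Holds s ↔ a.Holds s ∧ b.Holds s := by
  by_cases h : a.eval s = 0 <;> simp [Holds, land, eval, h]

theorem holds_ite_of_holds {c : NatExpr} (h : c.Holds s) : (ite c a b).Holds s ↔ a.Holds s := by
  unfold Holds at *
  rw [eval, if_pos h]

theorem holds_ite_of_not_holds {c : NatExpr} (h : ¬ c.Holds s) :
    (ite c a b).Holds s ↔ b.Holds s := by
  unfold Holds at *
  rw [eval, if_neg h]

theorem holds_lor : (lor a b).Holds s ↔ a.Holds s ∨ b.Holds s := by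
  by_cases h : a.eval s = 0 <;> simp [Holds, lor, eval, h]

theorem holds_lnot : (lnot a).Holds s ↔ ¬ a.Holds s := by
  by_cases h : a.eval s = 0 <;> simp [Holds, lnot, eval, h]

theorem eval_lnot : (lnot a).eval s = if a.eval s = 0 then 1 else 0 := by
  by_cases h : a.eval s = 0 <;> simp [lnot, eval, h]

theorem holds_lt : (lt a b).Holds s ↔ a.eval s < b.eval s := by
  simp only [Holds, lt, eval]; omega

theorem holds_eq : (eq a b).Holds s ↔ a.eval s = b.eval s := by
  rw [eq, holds_lnot]; simp only [Holds, absDiff, eval]; omega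

theorem holds_ex {x y : ℕ} (hxy : y ≠ x) (h : s.reg y ≤ s.reg 0) :
    (ex x y b).Holds s ↔ ∃ i < s.reg y, b.Holds (s.setReg x i) := by
  rw [ex, Holds, eval, Ne, Finset.sum_eq_zero_iff]
  push Not
  refine exists_congr fun i => ?_
  have := holds_land (a := lt (.var x) (.var y)) (b := b) (s := s.setReg x i)
  rw [holds_lt] at this
  simp only [eval, State.setReg_reg, hxy, if_true, if_false] at this
  rw [mem_range]
  exact ⟨fun h' => this.1 h'.2, fun h' => ⟨h'.1.trans_le h, this.2 h'⟩⟩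

theorem holds_all {x y : ℕ} (hxy : y ≠ x) (h : s.reg y ≤ s.reg 0) :
    (all x y b).Holds s ↔ ∀ i < s.reg y, b.Holds (s.setReg x i) := by
  rw [all, holds_lnot, holds_ex hxy h]
  simp only [holds_lnot]
  push Not
  rfl

theorem eval_addr (h : ∀ i, a.eval (s.setReg 20 i) = a.eval s) (ha : a.eval s ≤ s.reg 0) :
    (addr a b).eval s = 2 + a.eval s * s.reg 1 + b.eval s := by
  have : ∑ i ∈ range (s.reg 0), (if a.eval s - i ≠ 0 then s.reg 1 else 0) = a.eval s * s.reg 1 := by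
    rw [Finset.sum_ite, Finset.sum_const, Finset.sum_const_zero, add_zero, smul_eq_mul]
    congr 1
    rw [show (range (s.reg 0)).filter (fun i => a.eval s - i ≠ 0) = range (a.eval s) by
      ext i; simp only [mem_filter, mem_range]; omega, card_range]
  simp only [addr, lt, eval, h, State.setReg_reg, if_true]
  simpa using this

end NatExpr

/-- The row with index `k` of the matrix with `n` columns stored from address `2` on. -/
def row (n : ℕ) (μ : ℕ → ℕ) (k : ℕ) : Fin n → ZMod 2 := fun j => (μ (2 + k * n + j) : ZMod 2)

def rows (n m : ℕ) (μ : ℕ → ℕ) : Set (Fin n → ZMod 2) := {x | ∃ k < m, x = row n μ k}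

/-- The memory holds a 0-1 matrix with `m + 2` rows and `n` columns. -/
structure Ready (n m : ℕ) (s : State) : Prop where
  n_le : n ≤ s.reg 0
  m_le : m + 2 ≤ s.reg 0
  reg_one : s.reg 1 = n
  reg_two : s.reg 2 = m
  bits : ∀ k < m + 2, ∀ j < n, s.mem (2 + k * n + j) ≤ 1

namespace Ready

open NatExpr VectorSwitching

variable {n m : ℕ} {s : State}

theorem setReg (hs : Ready n m s) {x : ℕ} (hx : 3 ≤ x) (a : ℕ) : Ready n m (s.setReg x a) where
  n_le := by simpa [show 0 ≠ x by omega] using hs.n_le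
  m_le := by simpa [show 0 ≠ x by omega] using hs.m_le
  reg_one := by simpa [show 1 ≠ x by omega] using hs.reg_one
  reg_two := by simpa [show 2 ≠ x by omega] using hs.reg_two
  bits := hs.bits

theorem entry_eq_zero_iff (hs : Ready n m s) {k : ℕ} (hk : k < m + 2) (j : Fin n) :
    s.mem (2 + k * n + j) = 0 ↔ row n s.mem k j = 0 := by
  have := hs.bits k hk j j.2
  rw [row]
  interval_cases s.mem (2 + k * n + j) <;> simp

theorem entry_eq_iff (hs : Ready n m s) {k : ℕ} (hk : k < m + 2) (i j : Fin n) :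
    s.mem (2 + k * n + i) = s.mem (2 + k * n + j) ↔ row n s.mem k i = row n s.mem k j := by
  have h1 := hs.bits k hk j j.2
  have h2 := hs.bits k hk i i.2
  rw [row, row]
  interval_cases s.mem (2 + k * n + j) <;> interval_cases s.mem (2 + k * n + i) <;> simp

theorem eval_entry_of (hs : Ready n m s) {a b : NatExpr} (h : ∀ i, a.eval (s.setReg 20 i) = a.eval s)
    (ha : a.eval s < m + 2) : (entry a b).eval s = s.mem (2 + a.eval s * n + b.eval s) := by
  rw [entry, eval, eval_addr h (ha.le.trans hs.m_le), hs.reg_one]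

theorem holds_entry (hs : Ready n m s) {a b : NatExpr} (h : ∀ i, a.eval (s.setReg 20 i) = a.eval s)
    (ha : a.eval s < m + 2) (j : Fin n) (hb : b.eval s = j) :
    (entry a b).Holds s ↔ row n s.mem (a.eval s) j = 1 := by
  rw [Holds, hs.eval_entry_of h ha, hb, Ne, hs.entry_eq_zero_iff ha]
  exact ⟨eq_one_of_ne_zero, fun h1 h0 => by rw [h0] at h1; exact absurd h1 (by decide)⟩

theorem holds_ex_col (hs : Ready n m s) {x : ℕ} (hx : 3 ≤ x) {b : NatExpr} :
    (ex x 1 b).Holds s ↔ ∃ i : Fin n, b.Holds (s.setReg x i) := by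
  rw [holds_ex (by omega) (hs.reg_one.trans_le hs.n_le), hs.reg_one]
  exact ⟨fun ⟨i, hi, h⟩ => ⟨⟨i, hi⟩, h⟩, fun ⟨i, h⟩ => ⟨i, i.2, h⟩⟩

theorem holds_all_col (hs : Ready n m s) {x : ℕ} (hx : 3 ≤ x) {b : NatExpr} :
    (all x 1 b).Holds s ↔ ∀ i : Fin n, b.Holds (s.setReg x i) := by
  rw [holds_all (by omega) (hs.reg_one.trans_le hs.n_le), hs.reg_one]
  exact ⟨fun h i => h i i.2, fun h i hi => h ⟨i, hi⟩⟩

theorem reg_two_le (hs : Ready n m s) : s.reg 2 ≤ s.reg 0 := by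
  have := hs.m_le
  have := hs.reg_two
  omega

end Ready

/-! ### The conditions on twins -/

namespace NatExpr

def twin (x y : ℕ) : NatExpr := all 21 2 (eq (entry (.var 21) (.var x)) (entry (.var 21) (.var y)))

/-- The row with index `m + c` is zero. -/
def zeroRow (c : ℕ) : NatExpr := all 10 1 (lnot (entry (.add (.var 2) (.lit c)) (.var 10)))

def splitsTwins : NatExpr :=
  ex 10 1 (ex 11 1 (land (twin 10 11)
    (lnot (eq (entry (.var 2) (.var 10)) (entry (.var 2) (.var 11))))))

def thick : NatExpr :=
  ex 12 2 (ex 13 1 (ex 14 1 (ex 15 1 (land (entry (.var 12) (.var 13))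
    (land (entry (.var 12) (.var 14)) (land (entry (.var 12) (.var 15))
      (land (lnot (twin 13 14)) (land (lnot (twin 14 15)) (lnot (twin 13 15))))))))))

def notAllOnes : NatExpr := ex 10 1 (lnot (entry (.add (.var 2) (.lit 1)) (.var 10)))

def onTwins : NatExpr :=
  all 10 1 (all 11 1 (lor (lnot (land (entry (.add (.var 2) (.lit 1)) (.var 10))
    (entry (.add (.var 2) (.lit 1)) (.var 11)))) (twin 10 11)))

def flag : NatExpr := lor splitsTwins (lor (land thick notAllOnes) onTwins)

end NatExpr

namespace Ready

open NatExpr VectorSwitching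

variable {n m : ℕ} {s : State}

theorem holds_twin (hs : Ready n m s) {x y : ℕ} (hx : x < 20) (hy : y < 20) (u v : Fin n)
    (hu : s.reg x = u) (hv : s.reg y = v) :
    (twin x y).Holds s ↔ Twin (rows n m s.mem) u v := by
  rw [twin, holds_all (by decide) hs.reg_two_le, hs.reg_two]
  have key : ∀ k < m, ((eq (entry (.var 21) (.var x)) (entry (.var 21) (.var y))).Holds
      (s.setReg 21 k) ↔ row n s.mem k u = row n s.mem k v) := by
    intro k hk
    have hs' := hs.setReg (x := 21) (by decide) k
    rw [holds_eq, hs'.eval_entry_of (fun i => by simp [eval]) (by simp [eval]; omega),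
      hs'.eval_entry_of (fun i => by simp [eval]) (by simp [eval]; omega)]
    simp only [eval, State.setReg_reg, if_true, State.setReg_mem, show x ≠ 21 by omega,
      show y ≠ 21 by omega, if_false, hu, hv]
    exact hs.entry_eq_iff (by omega) u v
  constructor
  · rintro h e ⟨k, hk, rfl⟩
    exact (key k hk).1 (h k hk)
  · exact fun h k hk => (key k hk).2 (h _ ⟨k, hk, rfl⟩)

theorem holds_zeroRow (hs : Ready n m s) {c : ℕ} (hc : c < 2) :
    (zeroRow c).Holds s ↔ row n s.mem (m + c) = 0 := by
  rw [zeroRow, hs.holds_all_col (by decide), funext_iff]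
  refine forall_congr' fun i => ?_
  have hs' := hs.setReg (x := 10) (by decide) i
  rw [holds_lnot, hs'.holds_entry (fun i => by simp [eval]) (by simp [eval, hs.reg_two, hc]) i
    (by simp [eval])]
  simp only [eval, State.setReg_reg, State.setReg_mem, hs.reg_two, show ¬ 2 = 10 by decide, if_false]
  exact ⟨eq_zero_of_ne_one, fun h0 h1 => by rw [h1] at h0; exact absurd h0 one_ne_zero⟩

theorem holds_notAllOnes (hs : Ready n m s) :
    notAllOnes.Holds s ↔ row n s.mem (m + 1) ≠ 1 := by
  rw [notAllOnes, hs.holds_ex_col (by decide), Function.ne_iff]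
  refine exists_congr fun i => ?_
  have hs' := hs.setReg (x := 10) (by decide) i
  rw [holds_lnot, hs'.holds_entry (fun i => by simp [eval]) (by simp [eval, hs.reg_two]) i
    (by simp [eval])]
  simp [eval, hs.reg_two]

theorem holds_splitsTwins (hs : Ready n m s) :
    splitsTwins.Holds s ↔ SplitsTwins (rows n m s.mem) (row n s.mem m) := by
  rw [splitsTwins, hs.holds_ex_col (by decide)]
  refine exists_congr fun u => ?_
  have hu := hs.setReg (x := 10) (by decide) u
  rw [hu.holds_ex_col (by decide)]
  refine exists_congr fun v => ?_
  have hv := hu.setReg (x := 11) (by decide) v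
  rw [holds_land, hv.holds_twin (by decide) (by decide) u v (by simp) (by simp), holds_lnot, holds_eq,
    hv.eval_entry_of (fun i => by simp [eval]) (by simp [eval, hs.reg_two]),
    hv.eval_entry_of (fun i => by simp [eval]) (by simp [eval, hs.reg_two])]
  simp only [eval, hv.reg_two]
  rw [Ne, ← hs.entry_eq_iff (by omega) u v]
  simp

theorem holds_onTwins (hs : Ready n m s) :
    onTwins.Holds s ↔ OnTwins (rows n m s.mem) (row n s.mem (m + 1)) := by
  rw [onTwins, hs.holds_all_col (by decide)]
  refine forall_congr' fun u => ?_
  have hu := hs.setReg (x := 10) (by decide) u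
  rw [hu.holds_all_col (by decide)]
  refine forall_congr' fun v => ?_
  have hv := hu.setReg (x := 11) (by decide) v
  rw [holds_lor, hv.holds_twin (by decide) (by decide) u v (by simp) (by simp), holds_lnot, holds_land,
    hv.holds_entry (fun i => by simp [eval]) (by simp [eval, hs.reg_two]) u (by simp [eval]),
    hv.holds_entry (fun i => by simp [eval]) (by simp [eval, hs.reg_two]) v (by simp [eval])]
  simp only [eval, hv.reg_two, State.setReg_mem]
  tauto

theorem holds_thick (hs : Ready n m s) : thick.Holds s ↔ Thick (rows n m s.mem) := by
  rw [thick, holds_ex (by decide) hs.reg_two_le, hs.reg_two]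
  have key : ∀ k < m, ((ex 13 1 (ex 14 1 (ex 15 1 (land (entry (.var 12) (.var 13))
      (land (entry (.var 12) (.var 14)) (land (entry (.var 12) (.var 15))
      (land (lnot (twin 13 14)) (land (lnot (twin 14 15)) (lnot (twin 13 15))))))))) ).Holds
        (s.setReg 12 k) ↔ ∃ a b c, row n s.mem k a = 1 ∧ row n s.mem k b = 1 ∧ row n s.mem k c = 1 ∧
          ¬ Twin (rows n m s.mem) a b ∧ ¬ Twin (rows n m s.mem) b c ∧
          ¬ Twin (rows n m s.mem) a c) := by
    intro k hk
    have hs' := hs.setReg (x := 12) (by decide) k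
    rw [hs'.holds_ex_col (by decide)]
    refine exists_congr fun a => ?_
    have ha := hs'.setReg (x := 13) (by decide) a
    rw [ha.holds_ex_col (by decide)]
    refine exists_congr fun b => ?_
    have hb := ha.setReg (x := 14) (by decide) b
    rw [hb.holds_ex_col (by decide)]
    refine exists_congr fun c => ?_
    have hc := hb.setReg (x := 15) (by decide) c
    simp only [holds_land, holds_lnot]
    rw [hc.holds_twin (by decide) (by decide) a b (by simp) (by simp),
      hc.holds_twin (by decide) (by decide) b c (by simp) (by simp),
      hc.holds_twin (by decide) (by decide) a c (by simp) (by simp),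
      hc.holds_entry (fun i => by simp [eval]) (by simp [eval]; omega) a (by simp [eval]),
      hc.holds_entry (fun i => by simp [eval]) (by simp [eval]; omega) b (by simp [eval]),
      hc.holds_entry (fun i => by simp [eval]) (by simp [eval]; omega) c (by simp [eval])]
    simp [eval]
  constructor
  · rintro ⟨k, hk, h⟩
    exact ⟨_, ⟨k, hk, rfl⟩, (key k hk).1 h⟩
  · rintro ⟨_, ⟨k, hk, rfl⟩, h⟩
    exact ⟨k, hk, (key k hk).2 h⟩

theorem holds_flag (hs : Ready n m s) :
    flag.Holds s ↔ SplitsTwins (rows n m s.mem) (row n s.mem m) ∨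
      (Thick (rows n m s.mem) ∧ row n s.mem (m + 1) ≠ 1) ∨
      OnTwins (rows n m s.mem) (row n s.mem (m + 1)) := by
  rw [flag, holds_lor, holds_lor, holds_land, hs.holds_splitsTwins, hs.holds_thick,
    hs.holds_notAllOnes, hs.holds_onTwins]

end Ready

end RAM

/-! ### Gaussian elimination -/

namespace VectorSwitching

open Submodule

theorem setOf_lt_succ {F : Type} (R : ℕ → F) (i : ℕ) :
    {x | ∃ k < i + 1, x = R k} = insert (R i) {x | ∃ k < i, x = R k} := by
  ext x
  simp only [Set.mem_ofPred_eq, Set.mem_insert_iff, Nat.lt_succ_iff_lt_or_eq]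
  constructor
  · rintro ⟨k, hk | rfl, rfl⟩
    · exact .inr ⟨k, hk, rfl⟩
    · exact .inl rfl
  · rintro (rfl | ⟨k, hk, rfl⟩)
    · exact ⟨i, .inr rfl, rfl⟩
    · exact ⟨k, .inl hk, rfl⟩

/-- Eliminating the coordinate `j` with the pivot row `R i` reduces membership in the span of the
rows up to `R i` to membership in the span of the rows before it. -/
theorem mem_span_eliminate_iff {V : Type} {R R' : ℕ → V → ZMod 2} {i t : ℕ} {j : V}
    (hj : R i j = 1)
    (hR' : ∀ k, k < i ∨ k = t → R' k = if R k j = 1 then R k + R i else R k) :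
    R' t ∈ span (ZMod 2) {x | ∃ k < i, x = R' k} ↔
      R t ∈ span (ZMod 2) {x | ∃ k < i + 1, x = R k} := by
  have hzero : ∀ k, k < i ∨ k = t → R' k j = 0 := by
    intro k hk
    rw [hR' k hk]
    split_ifs with h
    · rw [Pi.add_apply, h, hj]; rfl
    · exact eq_zero_of_ne_one h
  have hback : ∀ k, k < i ∨ k = t → R k = R' k ∨ R k = R' k + R i := by
    intro k hk
    rw [hR' k hk]
    split_ifs
    · right; rw [add_add_self]
    · left; rfl
  have hspan : span (ZMod 2) {x | ∃ k < i + 1, x = R k} =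
      span (ZMod 2) (insert (R i) {x | ∃ k < i, x = R' k}) := by
    rw [setOf_lt_succ]
    apply le_antisymm <;> rw [span_le] <;> rintro x (rfl | ⟨k, hk, rfl⟩)
    · exact subset_span (Set.mem_insert _ _)
    · have h1 : R' k ∈ span (ZMod 2) (insert (R i) {x | ∃ k < i, x = R' k}) :=
        subset_span (.inr ⟨k, hk, rfl⟩)
      rcases hback k (.inl hk) with h | h
      · rw [h]; exact h1
      · rw [h]; exact add_mem h1 (subset_span (Set.mem_insert _ _))
    · exact subset_span (Set.mem_insert _ _)
    · have h1 : R k ∈ span (ZMod 2) (insert (R i) {x | ∃ k < i, x = R k}) :=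
        subset_span (.inr ⟨k, hk, rfl⟩)
      rw [hR' k (.inl hk)]
      split_ifs
      · exact add_mem h1 (subset_span (Set.mem_insert _ _))
      · exact h1
  have hRt : R t ∈ span (ZMod 2) (insert (R i) {x | ∃ k < i, x = R' k}) ↔
      R' t ∈ span (ZMod 2) (insert (R i) {x | ∃ k < i, x = R' k}) := by
    rcases hback t (.inr rfl) with h | h
    · rw [h]
    · rw [h, add_mem_cancel_right (subset_span (Set.mem_insert _ _))]
  rw [hspan, hRt]
  refine ⟨fun h => span_mono (Set.subset_insert _ _) h, fun h => ?_⟩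
  rcases mem_span_insert_cases h with h | h
  · exact h
  · exfalso
    have key : ∀ z ∈ span (ZMod 2) {x | ∃ k < i, x = R' k}, z j = 0 := by
      intro z hz
      induction hz using span_induction with
      | mem e he => obtain ⟨k, hk, rfl⟩ := he; exact hzero k (.inl hk)
      | zero => rfl
      | add x y _ _ hx hy => simp [hx, hy]
      | smul a x _ hx => simp [hx]
    have := key _ h
    rw [Pi.add_apply, hzero t (.inr rfl), hj] at this
    exact absurd this (by decide)

end VectorSwitching

namespace RAM

open NatExpr VectorSwitching Submodule

theorem address_injective {n k k' l l' : ℕ} (hl : l < n) (hl' : l' < n)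
    (h : 2 + k * n + l = 2 + k' * n + l') : k = k' ∧ l = l' := by
  have hn : 0 < n := by omega
  have h1 : l + n * k = l' + n * k' := by rw [mul_comm n k, mul_comm n k']; omega
  have h2 := congrArg (· / n) h1
  have h3 := congrArg (· % n) h1
  simp only [Nat.add_mul_div_left _ _ hn, Nat.div_eq_of_lt hl, Nat.div_eq_of_lt hl', zero_add] at h2
  simp only [Nat.add_mul_mod_self_left, Nat.mod_eq_of_lt hl, Nat.mod_eq_of_lt hl'] at h3
  exact ⟨h2, h3⟩

/-- Agreement in all registers outside of `X`. -/
def SameReg (X : Finset ℕ) (s s' : State) : Prop := ∀ x ∉ X, s'.reg x = s.reg x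

theorem SameReg.trans {X : Finset ℕ} {s s' s'' : State} (h : SameReg X s s') (h' : SameReg X s' s'') :
    SameReg X s s'' := fun x hx => (h' x hx).trans (h x hx)

theorem SameReg.mono {X Y : Finset ℕ} {s s' : State} (h : SameReg X s s') (hXY : X ⊆ Y) :
    SameReg Y s s' := fun x hx => h x fun h' => hx (hXY h')

theorem sameReg_setReg (s : State) (x a : ℕ) : SameReg {x} s (s.setReg x a) := fun y hy => by
  simp [show y ≠ x by simpa using hy]

theorem Ready.of_sameReg {n m : ℕ} {s s' : State} (hs : Ready n m s) {X : Finset ℕ}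
    (h : SameReg X s s') (h0 : 0 ∉ X) (h1 : 1 ∉ X) (h2 : 2 ∉ X)
    (hb : ∀ k < m + 2, ∀ j < n, s'.mem (2 + k * n + j) ≤ 1) : Ready n m s' where
  n_le := by rw [h 0 h0]; exact hs.n_le
  m_le := by rw [h 0 h0]; exact hs.m_le
  reg_one := by rw [h 1 h1]; exact hs.reg_one
  reg_two := by rw [h 2 h2]; exact hs.reg_two
  bits := hb

namespace Stmt

/-- Add the row whose index is in register `5` to the row whose index is in register `6`. -/
def addRow : Stmt :=
  .loop 7 (.ite (lt (.var 7) (.var 1)) (.store (addr (.var 6) (.var 7))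
    (absDiff (entry (.var 6) (.var 7)) (entry (.var 5) (.var 7)))) .skip)

/-- Put the index of a nonzero entry of the row whose index is in register `5` into register `8`, or
the number of columns if there is none. -/
def findPivot : Stmt :=
  .seq (.set 8 (.var 1)) (.loop 9 (.ite (land (lt (.var 9) (.var 1)) (entry (.var 5) (.var 9)))
    (.set 8 (.var 9)) .skip))

/-- Add the row whose index is in register `5` to all other rows that are nonzero in the column
whose index is in register `8`. -/
def eliminate : Stmt :=
  .loop 6 (.ite (land (lt (.var 6) (.add (.var 2) (.lit 2))) (land (lnot (eq (.var 6) (.var 5)))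
    (entry (.var 6) (.var 8)))) addRow .skip)

def gauss : Stmt :=
  .loop 5 (.ite (lt (.var 5) (.var 2)) (.seq findPivot (.ite (lt (.var 8) (.var 1)) eliminate .skip))
    .skip)

theorem exec_ite_of_holds {c : NatExpr} {p q : Stmt} {s : State} (h : c.Holds s) :
    (ite c p q).exec s = p.exec s := if_pos h

theorem exec_ite_of_not_holds {c : NatExpr} {p q : Stmt} {s : State} (h : ¬ c.Holds s) :
    (ite c p q).exec s = q.exec s := if_neg h

variable {n m : ℕ} {s : State}

theorem exec_addRow_entry (hs : Ready n m s) (h5 : s.reg 5 < m + 2) (h6 : s.reg 6 < m + 2) :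
    SameReg {7} s (addRow.exec s) ∧ ∀ k < m + 2, ∀ l < n, (addRow.exec s).mem (2 + k * n + l) =
      if k = s.reg 6 then (s.mem (2 + k * n + l) - s.mem (2 + s.reg 5 * n + l)) +
        (s.mem (2 + s.reg 5 * n + l) - s.mem (2 + k * n + l)) else s.mem (2 + k * n + l) := by
  have := countdown_induction (f := fun i u => (Stmt.ite (lt (.var 7) (.var 1))
    (.store (addr (.var 6) (.var 7)) (absDiff (entry (.var 6) (.var 7)) (entry (.var 5) (.var 7))))
      .skip).exec (u.setReg 7 i)) (n := s.reg 0) (s := s)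
    (fun j u => SameReg {7} s u ∧ ∀ k < m + 2, ∀ l < n, u.mem (2 + k * n + l) =
      if k = s.reg 6 ∧ j ≤ l then (s.mem (2 + k * n + l) - s.mem (2 + s.reg 5 * n + l)) +
        (s.mem (2 + s.reg 5 * n + l) - s.mem (2 + k * n + l)) else s.mem (2 + k * n + l))
    (by
      rintro j - u ⟨hreg, hmem⟩
      have hreg' : SameReg {7} s (u.setReg 7 j) := hreg.trans (sameReg_setReg u 7 j)
      have h7 : (u.setReg 7 j).reg 7 = j := by simp
      have hmem' : (u.setReg 7 j).mem = u.mem := rfl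
      generalize u.setReg 7 j = v at hreg' h7 hmem'
      have e6 := hreg' 6 (by decide)
      have e5 := hreg' 5 (by decide)
      have e1 := (hreg' 1 (by decide)).trans hs.reg_one
      have e0 := hreg' 0 (by decide)
      have hm := hs.m_le
      have ent : ∀ x < 20, v.reg x < m + 2 → (addr (.var x) (.var 7)).eval v = 2 + v.reg x * n + j := by
        intro x hx hx'
        rw [NatExpr.eval_addr (fun i => by simp [NatExpr.eval, hx.ne])
          (by simp only [NatExpr.eval]; omega), e1]
        simp only [NatExpr.eval, h7]
      by_cases hj : j < n
      · rw [exec_ite_of_holds (by rw [holds_lt]; simpa [NatExpr.eval, h7, e1] using hj)]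
        refine ⟨hreg', fun k hk l hl => ?_⟩
        simp only [exec, absDiff, entry, NatExpr.eval, ent 6 (by decide) (by omega),
          ent 5 (by decide) (by omega), State.setMem_mem, hmem', e5, e6]
        by_cases hkl : k = s.reg 6 ∧ l = j
        · obtain ⟨rfl, rfl⟩ := hkl
          rw [if_pos rfl, if_pos ⟨rfl, le_rfl⟩, hmem _ hk _ hl, hmem _ h5 _ hl,
            if_neg (by omega), if_neg (by omega)]
        · rw [if_neg fun h => hkl (address_injective hl hj h), hmem k hk l hl]
          refine if_congr ⟨fun h => ⟨h.1, by omega⟩, fun h => ⟨h.1, ?_⟩⟩ rfl rfl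
          have : l ≠ j := fun h' => hkl ⟨h.1, h'⟩
          omega
      · rw [exec_ite_of_not_holds (by rw [holds_lt]; simpa [NatExpr.eval, h7, e1] using hj)]
        refine ⟨hreg', fun k hk l hl => ?_⟩
        simp only [exec, hmem', hmem k hk l hl]
        exact if_congr (by omega) rfl rfl)
    ⟨fun _ _ => rfl, fun k _ l hl => by
      have := hs.n_le
      rw [if_neg (by omega)]⟩
  refine ⟨this.1, fun k hk l hl => ?_⟩
  rw [addRow, exec, this.2 k hk l hl]
  simp

theorem exec_addRow (hs : Ready n m s) (h5 : s.reg 5 < m + 2) (h6 : s.reg 6 < m + 2) :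
    Ready n m (addRow.exec s) ∧ SameReg {7} s (addRow.exec s) ∧
      ∀ k < m + 2, row n (addRow.exec s).mem k =
        if k = s.reg 6 then row n s.mem k + row n s.mem (s.reg 5) else row n s.mem k := by
  obtain ⟨hreg, hmem⟩ := exec_addRow_entry hs h5 h6
  refine ⟨hs.of_sameReg hreg (by decide) (by decide) (by decide) fun k hk l hl => ?_, hreg,
    fun k hk => ?_⟩
  · rw [hmem k hk l hl]
    have h1 := hs.bits k hk l hl
    have h2 := hs.bits _ h5 l hl
    split_ifs <;> omega
  · funext l
    have h1 := hs.bits k hk l l.2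
    have h2 := hs.bits _ h5 l l.2
    rw [row, hmem k hk l l.2]
    split_ifs
    · rw [Pi.add_apply, row, row]
      interval_cases s.mem (2 + k * n + l) <;> interval_cases s.mem (2 + s.reg 5 * n + l) <;> rfl
    · rfl

theorem exec_findPivot (hs : Ready n m s) (h5 : s.reg 5 < m + 2) :
    (findPivot.exec s).mem = s.mem ∧ SameReg {8, 9} s (findPivot.exec s) ∧
      (((findPivot.exec s).reg 8 = n ∧ row n s.mem (s.reg 5) = 0) ∨
        ∃ j : Fin n, (findPivot.exec s).reg 8 = j ∧ row n s.mem (s.reg 5) j = 1) := by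
  set s' := s.setReg 8 (s.reg 1) with hs'
  have := countdown_induction (f := fun i u => (Stmt.ite (land (lt (.var 9) (.var 1))
      (entry (.var 5) (.var 9))) (.set 8 (.var 9)) .skip).exec (u.setReg 9 i)) (n := s'.reg 0) (s := s')
    (fun j u => u.mem = s.mem ∧ SameReg {8, 9} s u ∧
      ((u.reg 8 = n ∧ ∀ l : Fin n, j ≤ l → row n s.mem (s.reg 5) l = 0) ∨
        ∃ l : Fin n, u.reg 8 = l ∧ row n s.mem (s.reg 5) l = 1))
    (by
      rintro j - u ⟨hmem, hreg, h8⟩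
      have hreg' : SameReg {8, 9} s (u.setReg 9 j) :=
        hreg.trans ((sameReg_setReg u 9 j).mono (by decide))
      have h9 : (u.setReg 9 j).reg 9 = j := by simp
      have hmem' : (u.setReg 9 j).mem = s.mem := hmem
      have h8' : (u.setReg 9 j).reg 8 = u.reg 8 := by simp
      rw [← h8'] at h8
      generalize u.setReg 9 j = v at hreg' h9 hmem' h8
      have hv : Ready n m v := hs.of_sameReg hreg' (by decide) (by decide) (by decide)
        (by rw [hmem']; exact hs.bits)
      have e5 := hreg' 5 (by decide)
      have hlt : (lt (.var 9) (.var 1)).Holds v ↔ j < n := by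
        rw [holds_lt]; simp [NatExpr.eval, h9, hv.reg_one]
      have hent : ∀ hj : j < n, (entry (.var 5) (.var 9)).Holds v ↔
          row n s.mem (s.reg 5) ⟨j, hj⟩ = 1 := by
        intro hj
        rw [hv.holds_entry (fun i => by simp [NatExpr.eval]) (by simp only [NatExpr.eval]; omega)
          ⟨j, hj⟩ (by simp [NatExpr.eval, h9])]
        simp [NatExpr.eval, hmem', e5]
      by_cases hc : (land (lt (.var 9) (.var 1)) (entry (.var 5) (.var 9))).Holds v
      · rw [exec_ite_of_holds hc]
        rw [holds_land, hlt] at hc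
        refine ⟨hmem', hreg'.trans ((sameReg_setReg v 8 _).mono (by decide)), .inr
          ⟨⟨j, hc.1⟩, by simp [exec, NatExpr.eval, h9], (hent hc.1).1 hc.2⟩⟩
      · rw [exec_ite_of_not_holds hc]
        rw [holds_land, hlt] at hc
        refine ⟨hmem', hreg', ?_⟩
        rcases h8 with ⟨h8, hz⟩ | h
        · refine .inl ⟨h8, fun l hl => ?_⟩
          by_cases hlj : l = j
          · refine eq_zero_of_ne_one fun h1 => hc ⟨hlj ▸ l.2, ?_⟩
            rw [hent (hlj ▸ l.2), ← h1]
            congr 1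
            exact Fin.ext hlj.symm
          · exact hz l (by omega)
        · exact .inr h)
    ⟨rfl, (sameReg_setReg s 8 _).mono (by decide), .inl ⟨by simp [hs', hs.reg_one], fun l hl => by
      have h1 : s'.reg 0 = s.reg 0 := by simp [hs']
      have := hs.n_le
      have := l.2
      omega⟩⟩
  obtain ⟨h1, h2, h3⟩ := this
  refine ⟨h1, h2, ?_⟩
  rcases h3 with ⟨h8, hz⟩ | h
  · exact .inl ⟨h8, funext fun l => hz l (Nat.zero_le _)⟩
  · exact .inr h

theorem exec_eliminate (hs : Ready n m s) (h5 : s.reg 5 < m + 2) {j : Fin n} (h8 : s.reg 8 = j) :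
    Ready n m (eliminate.exec s) ∧ SameReg {6, 7} s (eliminate.exec s) ∧
      ∀ k < m + 2, row n (eliminate.exec s).mem k = if k ≠ s.reg 5 ∧ row n s.mem k j = 1 then
        row n s.mem k + row n s.mem (s.reg 5) else row n s.mem k := by
  have := countdown_induction (f := fun i u => (Stmt.ite (land (lt (.var 6) (.add (.var 2) (.lit 2)))
      (land (lnot (eq (.var 6) (.var 5))) (entry (.var 6) (.var 8)))) addRow .skip).exec (u.setReg 6 i))
    (n := s.reg 0) (s := s)
    (fun t u => Ready n m u ∧ SameReg {6, 7} s u ∧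
      ∀ k < m + 2, row n u.mem k = if t ≤ k ∧ k ≠ s.reg 5 ∧ row n s.mem k j = 1 then
        row n s.mem k + row n s.mem (s.reg 5) else row n s.mem k)
    (by
      rintro t - u ⟨hu, hreg, hrow⟩
      have hreg' : SameReg {6, 7} s (u.setReg 6 t) :=
        hreg.trans ((sameReg_setReg u 6 t).mono (by decide))
      have h6 : (u.setReg 6 t).reg 6 = t := by simp
      have hmem' : (u.setReg 6 t).mem = u.mem := rfl
      have hv := hu.setReg (x := 6) (by decide) t
      generalize u.setReg 6 t = v at hreg' h6 hmem' hv
      rw [← hmem'] at hrow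
      have e5 := hreg' 5 (by decide)
      have e8 := (hreg' 8 (by decide)).trans h8
      have hcond : (land (lt (.var 6) (.add (.var 2) (.lit 2))) (land (lnot (eq (.var 6) (.var 5)))
          (entry (.var 6) (.var 8)))).Holds v ↔ t < m + 2 ∧ t ≠ s.reg 5 ∧ row n s.mem t j = 1 := by
        rw [holds_land, holds_land, holds_lnot, holds_lt, holds_eq]
        simp only [NatExpr.eval, h6, hv.reg_two, e5]
        refine and_congr_right fun ht => and_congr_right fun _ => ?_
        rw [hv.holds_entry (fun i => by simp [NatExpr.eval]) (by simp only [NatExpr.eval]; omega) j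
          (by simp [NatExpr.eval, e8])]
        simp only [NatExpr.eval, h6, hrow t ht]
        rw [if_neg (by omega)]
      by_cases hc : t < m + 2 ∧ t ≠ s.reg 5 ∧ row n s.mem t j = 1
      · rw [exec_ite_of_holds (hcond.2 hc)]
        obtain ⟨ht, hne, h1⟩ := hc
        obtain ⟨ha, hb, hd⟩ := exec_addRow hv (by omega) (by omega)
        refine ⟨ha, hreg'.trans (hb.mono (by decide)), fun k hk => ?_⟩
        rw [hd k hk, h6, e5, hrow k hk, hrow _ h5]
        by_cases hkt : k = t
        · subst hkt
          rw [if_pos rfl, if_neg (by omega), if_neg (by tauto), if_pos ⟨le_rfl, hne, h1⟩]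
        · rw [if_neg hkt]
          exact if_congr (and_congr_left fun _ => by omega) rfl rfl
      · rw [exec_ite_of_not_holds (fun h => hc (hcond.1 h))]
        refine ⟨hv, hreg', fun k hk => ?_⟩
        rw [exec, hrow k hk]
        refine if_congr ⟨fun h => ⟨by omega, h.2⟩, fun h => ⟨?_, h.2⟩⟩ rfl rfl
        have : k ≠ t := fun hkt => hc ⟨hkt ▸ hk, hkt ▸ h.2⟩
        omega)
    ⟨hs, fun _ _ => rfl, fun k hk => by
      have := hs.m_le
      rw [if_neg (by omega)]⟩
  obtain ⟨h1, h2, h3⟩ := this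
  refine ⟨h1, h2, fun k hk => ?_⟩
  rw [eliminate, exec, h3 k hk]
  simp

theorem exec_gauss (hs : Ready n m s) :
    Ready n m (gauss.exec s) ∧ SameReg {5, 6, 7, 8, 9} s (gauss.exec s) ∧
      ∀ r < m + 2, m ≤ r → (row n (gauss.exec s).mem r = 0 ↔
        row n s.mem r ∈ span (ZMod 2) (rows n m s.mem)) := by
  have := countdown_induction (f := fun i u => (Stmt.ite (lt (.var 5) (.var 2))
      (.seq findPivot (.ite (lt (.var 8) (.var 1)) eliminate .skip)) .skip).exec (u.setReg 5 i))
    (n := s.reg 0) (s := s)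
    (fun t u => Ready n m u ∧ SameReg {5, 6, 7, 8, 9} s u ∧ ∀ r < m + 2, m ≤ r →
      (row n u.mem r ∈ span (ZMod 2) {x | ∃ k < min t m, x = row n u.mem k} ↔
        row n s.mem r ∈ span (ZMod 2) (rows n m s.mem)))
    (by
      rintro t - u ⟨hu, hreg, hrow⟩
      have hreg' : SameReg {5, 6, 7, 8, 9} s (u.setReg 5 t) :=
        hreg.trans ((sameReg_setReg u 5 t).mono (by decide))
      have h5 : (u.setReg 5 t).reg 5 = t := by simp
      have hmem' : (u.setReg 5 t).mem = u.mem := rfl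
      have hv := hu.setReg (x := 5) (by decide) t
      generalize u.setReg 5 t = v at hreg' h5 hmem' hv
      rw [← hmem'] at hrow
      have hcond : (lt (.var 5) (.var 2)).Holds v ↔ t < m := by
        rw [holds_lt]; simp [NatExpr.eval, h5, hv.reg_two]
      by_cases ht : t < m
      · rw [exec_ite_of_holds (hcond.2 ht), exec]
        obtain ⟨pm, preg, hp⟩ := exec_findPivot hv (by omega)
        generalize findPivot.exec v = w at pm preg hp
        have hw := hv.of_sameReg preg (by decide) (by decide) (by decide) (by rw [pm]; exact hv.bits)
        have w5 : w.reg 5 = t := (preg 5 (by decide)).trans h5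
        have hregw := hreg'.trans (preg.mono (by decide))
        rw [h5, ← pm] at hp
        rw [← pm] at hrow
        have hcond : (lt (.var 8) (.var 1)).Holds w ↔ w.reg 8 < n := by
          rw [holds_lt]; simp [NatExpr.eval, hw.reg_one]
        simp only [min_eq_left (Nat.succ_le_of_lt ht)] at hrow
        simp only [min_eq_left ht.le]
        rcases hp with ⟨h8, hz⟩ | ⟨j, h8, hj⟩
        · rw [exec_ite_of_not_holds (by rw [hcond]; omega), exec]
          refine ⟨hw, hregw, fun r hr hmr => ?_⟩
          rw [← hrow r hr hmr, setOf_lt_succ, hz, span_insert_zero]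
        · rw [exec_ite_of_holds (by rw [hcond]; omega)]
          obtain ⟨ha, hb, hd⟩ := exec_eliminate hw (by omega) h8
          refine ⟨ha, hregw.trans (hb.mono (by decide)), fun r hr hmr => ?_⟩
          rw [← hrow r hr hmr]
          refine mem_span_eliminate_iff hj fun k hk => ?_
          rw [hd k (by omega), w5]
          exact if_congr (and_iff_right (by omega)) rfl rfl
      · rw [exec_ite_of_not_holds (by rwa [hcond]), exec]
        refine ⟨hv, hreg', fun r hr hmr => ?_⟩
        rw [← hrow r hr hmr, min_eq_right (by omega), min_eq_right (by omega)])
    ⟨hs, fun _ _ => rfl, fun r _ _ => by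
      have := hs.m_le
      rw [min_eq_right (by omega)]; rfl⟩
  obtain ⟨h1, h2, h3⟩ := this
  refine ⟨h1, h2, fun r hr hmr => ?_⟩
  rw [← h3 r hr hmr]
  simp [gauss, exec]

end Stmt
end RAM

/-! ### The decision procedure -/

namespace RAM

open NatExpr VectorSwitching Submodule

/-- Evaluate the conditions on twins and on `w₂`, then test with Gaussian elimination whether `w₁`
and `w₁ + w₂` are in the span of the edges. -/
def recurrenceStmt : Stmt :=
  .seq (.set 1 (.mem (.lit 0))) (.seq (.set 2 (.mem (.lit 1))) (.seq (.set 3 (zeroRow 1))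
    (.seq (.set 4 flag) (.seq (.set 6 (.add (.var 2) (.lit 1))) (.seq (.set 5 (.var 2))
      (.seq .addRow .gauss))))))

def recurrenceAnswer : NatExpr :=
  lnot (lnot (.ite (zeroRow 0) (.var 3) (land (zeroRow 1) (.var 4))))

theorem recurrenceStmt_below : recurrenceStmt.Below 30 := by
  simp [recurrenceStmt, Stmt.Below, NatExpr.Below, Stmt.addRow, Stmt.gauss, Stmt.findPivot,
    Stmt.eliminate, flag, splitsTwins, thick, notAllOnes, onTwins, zeroRow, twin, ex, all, land, lor,
    lnot, NatExpr.lt, NatExpr.eq, NatExpr.absDiff, entry, addr]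

theorem recurrenceAnswer_below : recurrenceAnswer.Below 30 := by
  simp [recurrenceAnswer, NatExpr.Below, zeroRow, ex, all, land, lnot, NatExpr.lt, entry, addr]

theorem eval_recurrenceAnswer {n m : ℕ} {s : State} (hn : n ≤ s.reg 0) (hm : m + 2 ≤ s.reg 0)
    (h0 : s.mem 0 = n) (h1 : s.mem 1 = m)
    (hbits : ∀ k < m + 2, ∀ j < n, s.mem (2 + k * n + j) ≤ 1) {P : Prop}
    (hin : row n s.mem m ∈ span (ZMod 2) (rows n m s.mem) → (P ↔ row n s.mem (m + 1) = 0))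
    (hout : row n s.mem m ∉ span (ZMod 2) (rows n m s.mem) →
      (P ↔ row n s.mem m + row n s.mem (m + 1) ∈ span (ZMod 2) (rows n m s.mem) ∧
        (SplitsTwins (rows n m s.mem) (row n s.mem m) ∨
          (Thick (rows n m s.mem) ∧ row n s.mem (m + 1) ≠ 1) ∨
          OnTwins (rows n m s.mem) (row n s.mem (m + 1))))) :
    (P ∧ recurrenceAnswer.eval (recurrenceStmt.exec s) = 1) ∨
      (¬ P ∧ recurrenceAnswer.eval (recurrenceStmt.exec s) = 0) := by
  obtain ⟨s₂, hs₂⟩ : ∃ s₂, s₂ = (s.setReg 1 n).setReg 2 m := ⟨_, rfl⟩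
  have hr₂ : Ready n m s₂ := by
    subst hs₂
    constructor <;> simp_all
  have hm₂ : s₂.mem = s.mem := by subst hs₂; rfl
  obtain ⟨s₃, hs₃⟩ : ∃ s₃, s₃ = s₂.setReg 3 ((zeroRow 1).eval s₂) := ⟨_, rfl⟩
  have hr₃ : Ready n m s₃ := hs₃ ▸ hr₂.setReg (by decide) _
  obtain ⟨s₄, hs₄⟩ : ∃ s₄, s₄ = ((s₃.setReg 4 (flag.eval s₃)).setReg 6 (m + 1)).setReg 5 m := ⟨_, rfl⟩
  have hr₄ : Ready n m s₄ := hs₄ ▸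
    ((hr₃.setReg (by decide) _).setReg (by decide) _).setReg (by decide) _
  have hm₄ : s₄.mem = s.mem := by rw [hs₄, hs₃, ← hm₂]; rfl
  have e5 : s₄.reg 5 = m := by simp [hs₄]
  have e6 : s₄.reg 6 = m + 1 := by simp [hs₄]
  obtain ⟨hr₅, hreg₅, hrow₅⟩ := Stmt.exec_addRow hr₄ (by omega) (by omega)
  have hexec : recurrenceStmt.exec s = Stmt.gauss.exec (Stmt.addRow.exec s₄) := by
    simp only [recurrenceStmt, Stmt.exec, NatExpr.eval, h0, State.setReg_mem, h1, ← hs₂, ← hs₃]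
    congr 2
    rw [hs₄]
    have h2 : (s₃.setReg 4 (flag.eval s₃)).reg 2 = m := by simp [hr₃.reg_two]
    have h2' : ((s₃.setReg 4 (flag.eval s₃)).setReg 6 (m + 1)).reg 2 = m := by simp [hr₃.reg_two]
    rw [h2, h2']
  rw [hexec]
  obtain ⟨hr₆, hreg₆, hrow₆⟩ := Stmt.exec_gauss hr₅
  generalize Stmt.addRow.exec s₄ = s₅ at *
  generalize Stmt.gauss.exec s₅ = s₆ at *
  have hE : rows n m s₅.mem = rows n m s.mem := by
    ext x
    refine exists_congr fun k => and_congr_right fun hk => ?_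
    rw [hrow₅ k (by omega), if_neg (by omega), hm₄]
  have hrm := hrow₆ m (by omega) le_rfl
  have hrm1 := hrow₆ (m + 1) (by omega) (by omega)
  rw [hE, hrow₅ m (by omega), if_neg (by omega), hm₄] at hrm
  rw [hE, hrow₅ (m + 1) (by omega), if_pos e6.symm, e5, hm₄,
    add_comm (row n s.mem (m + 1))] at hrm1
  have e3 : (NatExpr.var 3).Holds s₆ ↔ row n s.mem (m + 1) = 0 := by
    rw [← hm₂, ← hr₂.holds_zeroRow (by decide), Holds, Holds, NatExpr.eval, hreg₆ 3 (by decide),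
      hreg₅ 3 (by decide)]
    simp [hs₄, hs₃]
  have e4 : (NatExpr.var 4).Holds s₆ ↔ SplitsTwins (rows n m s.mem) (row n s.mem m) ∨
      (Thick (rows n m s.mem) ∧ row n s.mem (m + 1) ≠ 1) ∨
      OnTwins (rows n m s.mem) (row n s.mem (m + 1)) := by
    have : s₃.mem = s.mem := by rw [hs₃, ← hm₂]; rfl
    rw [← this, ← hr₃.holds_flag, Holds, Holds, NatExpr.eval, hreg₆ 4 (by decide),
      hreg₅ 4 (by decide)]
    simp [hs₄]
  have hz0 := hr₆.holds_zeroRow (c := 0) (by decide)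
  have hz1 := hr₆.holds_zeroRow (c := 1) (by decide)
  rw [add_zero, hrm] at hz0
  rw [hrm1] at hz1
  have hP : P ↔ (NatExpr.ite (zeroRow 0) (.var 3) (land (zeroRow 1) (.var 4))).Holds s₆ := by
    by_cases h : (zeroRow 0).Holds s₆
    · rw [hin (hz0.1 h), ← e3, holds_ite_of_holds h]
    · rw [hout fun h' => h (hz0.2 h'), ← hz1, ← e4, ← holds_land,
        holds_ite_of_not_holds h]
  rw [recurrenceAnswer, eval_lnot, eval_lnot]
  by_cases h : P
  · left
    have h' := hP.1 h
    rw [Holds] at h'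
    exact ⟨h, by rw [if_neg h']; rfl⟩
  · right
    have h' := mt hP.2 h
    rw [Holds, not_not] at h'
    exact ⟨h, by rw [if_pos h']; rfl⟩

theorem getD_flatten {n : ℕ} : ∀ {R : List (List ℕ)}, (∀ r ∈ R, r.length = n) → ∀ (k : ℕ) {j : ℕ},
    j < n → R.flatten.getD (k * n + j) 0 = (R.getD k []).getD j 0
  | [], _, k, j, _ => by simp
  | r :: R, h, 0, j, hj => by
      have hr : r.length = n := h r (by simp)
      rw [zero_mul, zero_add, List.flatten_cons, List.getD_append _ _ _ _ (hr.symm ▸ hj),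
        List.getD_cons_zero]
  | r :: R, h, k + 1, j, hj => by
      have hr : r.length = n := h r (by simp)
      rw [List.flatten_cons, List.getD_append_right _ _ _ _ (by rw [hr]; nlinarith), hr,
        show (k + 1) * n + j - n = k * n + j by rw [add_mul, one_mul]; omega,
        getD_flatten (fun r' hr' => h r' (by simp [hr'])) k hj, List.getD_cons_succ]

end RAM

namespace RecurrenceInput

open RAM

/-- The rows of the 0-1 matrix in the encoding. -/
def matrix (I : RecurrenceInput) : List (List ℕ) :=
  I.edges.map (fun e => List.ofFn fun v => if v ∈ e then 1 else 0) ++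
    [List.ofFn fun v => (I.w₁ v).val, List.ofFn fun v => (I.w₂ v).val]

theorem encode_eq (I : RecurrenceInput) :
    I.encode = I.n :: I.edges.length :: I.matrix.flatten := by
  simp [encode, matrix, List.flatMap]

theorem length_of_mem_matrix (I : RecurrenceInput) : ∀ r ∈ I.matrix, r.length = I.n := by
  intro r hr
  simp only [matrix, List.mem_append, List.mem_map, List.mem_cons, List.not_mem_nil, or_false] at hr
  rcases hr with ⟨e, -, rfl⟩ | rfl | rfl <;> simp

theorem length_encode (I : RecurrenceInput) :
    I.encode.length = 2 + (I.edges.length + 2) * I.n := by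
  have : ∀ R : List (List ℕ), (∀ r ∈ R, r.length = I.n) → R.flatten.length = R.length * I.n := by
    intro R
    induction R with
    | nil => simp
    | cons r R ih =>
      intro h
      rw [List.flatten_cons, List.length_append, h r (by simp), ih fun r' hr' => h r' (by simp [hr'])]
      simp [add_mul, add_comm]
  rw [encode_eq, List.length_cons, List.length_cons, this _ I.length_of_mem_matrix]
  simp [matrix]; ring

theorem start_mem (I : RecurrenceInput) (k : ℕ) (j : Fin I.n) :
    (start I.encode).mem (2 + k * I.n + j) = (I.matrix.getD k []).getD j 0 := by
  rw [← getD_flatten I.length_of_mem_matrix k j.2, start, encode_eq,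
    show 2 + k * I.n + (j : ℕ) = k * I.n + j + 1 + 1 by ring]
  simp

theorem start_mem_edge (I : RecurrenceInput) {k : ℕ} (hk : k < I.edges.length) (j : Fin I.n) :
    (start I.encode).mem (2 + k * I.n + j) = if j ∈ I.edges[k] then 1 else 0 := by
  rw [start_mem, matrix, List.getD_append _ _ _ _ (by simpa using hk)]
  simp [List.getD, hk]

theorem start_mem_w₁ (I : RecurrenceInput) (j : Fin I.n) :
    (start I.encode).mem (2 + I.edges.length * I.n + j) = (I.w₁ j).val := by
  rw [start_mem, matrix, List.getD_append_right _ _ _ _ (by simp)]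
  simp [List.getD]

theorem start_mem_w₂ (I : RecurrenceInput) (j : Fin I.n) :
    (start I.encode).mem (2 + (I.edges.length + 1) * I.n + j) = (I.w₂ j).val := by
  rw [start_mem, matrix, List.getD_append_right _ _ _ _ (by simp)]
  simp [List.getD]

theorem start_mem_le_one (I : RecurrenceInput) : ∀ k < I.edges.length + 2, ∀ j < I.n,
    (start I.encode).mem (2 + k * I.n + j) ≤ 1 := by
  intro k hk j hj
  have hval : ∀ a : ZMod 2, a.val ≤ 1 := by decide
  rcases Nat.lt_or_ge k I.edges.length with h | h
  · rw [I.start_mem_edge h ⟨j, hj⟩]; split_ifs <;> omega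
  · obtain rfl | rfl : k = I.edges.length ∨ k = I.edges.length + 1 := by omega
    · rw [I.start_mem_w₁ ⟨j, hj⟩]; exact hval _
    · rw [I.start_mem_w₂ ⟨j, hj⟩]; exact hval _

theorem row_w₁ (I : RecurrenceInput) : row I.n (start I.encode).mem I.edges.length = I.w₁ := by
  funext j
  rw [row, start_mem_w₁, ZMod.natCast_val, ZMod.cast_id', id]

theorem row_w₂ (I : RecurrenceInput) : row I.n (start I.encode).mem (I.edges.length + 1) = I.w₂ := by
  funext j
  rw [row, start_mem_w₂, ZMod.natCast_val, ZMod.cast_id', id]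

theorem rows_edges (I : RecurrenceInput) : rows I.n I.edges.length (start I.encode).mem =
    HyperedgeSwitching.edgeVectors I.hypergraph := by
  have hrow : ∀ k (hk : k < I.edges.length), row I.n (start I.encode).mem k =
      fun v => if v ∈ I.edges[k] then 1 else 0 := by
    intro k hk
    funext j
    rw [row, I.start_mem_edge hk]
    split_ifs <;> simp
  ext x
  constructor
  · rintro ⟨k, hk, rfl⟩
    refine ⟨_, ⟨I.edges[k], List.getElem_mem hk, rfl⟩, ?_⟩
    rw [hrow k hk]
    funext v
    by_cases hv : v ∈ I.edges[k] <;> simp [hv]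
  · rintro ⟨_, ⟨e, he, rfl⟩, rfl⟩
    obtain ⟨k, hk, rfl⟩ := List.getElem_of_mem he
    refine ⟨k, hk, ?_⟩
    rw [hrow k hk]
    funext v
    by_cases hv : v ∈ I.edges[k] <;> simp [hv]

end RecurrenceInput

theorem theorem2 :
    RAM.DecidableInPolyTime RecurrenceInput.encode
      (fun I => HyperedgeSwitching.IsConnected I.hypergraph ∧
        HyperedgeSwitching.NoGraphEdges I.hypergraph ∧ I.w₁ ≠ 0)
      (fun I => HyperedgeSwitching.IsRecurrent I.hypergraph I.w₁ I.w₂) := by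
  refine RAM.decidableInPolyTime_of_exec (K := 30) (by decide) RAM.recurrenceStmt
    RAM.recurrenceStmt_below RAM.recurrenceAnswer RAM.recurrenceAnswer_below ?_
  rintro I ⟨hconn, hsize, hw⟩
  have hn : 1 ≤ I.n := by
    obtain ⟨v, -⟩ := Function.ne_iff.1 hw
    exact v.pos
  have hlen : (RAM.start I.encode).reg 0 = 2 + (I.edges.length + 2) * I.n := by
    rw [← I.length_encode]; rfl
  have hc := hconn.connected rfl
  have h0 := hsize.ne_zero
  have hrec : HyperedgeSwitching.IsRecurrent I.hypergraph I.w₁ I.w₂ ↔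
      ∀ z, VectorSwitching.Reach (HyperedgeSwitching.edgeVectors I.hypergraph) I.w₁ z →
        VectorSwitching.Reach (HyperedgeSwitching.edgeVectors I.hypergraph) z I.w₂ := by
    simp only [HyperedgeSwitching.isRecurrent_iff, HyperedgeSwitching.reachable_iff]
  refine RAM.eval_recurrenceAnswer (n := I.n) (m := I.edges.length) (by rw [hlen]; nlinarith)
    (by rw [hlen]; nlinarith) (by simp [RAM.start, I.encode_eq]) (by simp [RAM.start, I.encode_eq])
    I.start_mem_le_one ?_ ?_
  · rw [I.row_w₁, I.row_w₂, I.rows_edges, hrec]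
    exact fun hx => hc.recurrent_iff_of_mem h0 hx I.w₂
  · rw [I.row_w₁, I.row_w₂, I.rows_edges, hrec]
    exact fun hx => hc.recurrent_iff_of_not_mem h0 hx I.w₂
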